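/- **Model.** A platform with $L$ drivers serves riders. A state is $(l,m)\in\mathcal S=\{0,\dots,L\}\times\mathbb Z_{\ge 0}$: $l$ drivers are in service and $m$ riders wait in the queue. Potential riders arrive at rate $\Lambda>0$. A rider's willingness to pay per kilometer has distribution function $F$, and $\bar F=1-F$ is strictly decreasing on $[0,p_{\max}]$ with $\bar F(0)=1$, $\bar F(p_{\max})=0$; the map $p\mapsto\Lambda\bar F(p)$ is a bijection of $[0,p_{\max}]$ onto $[0,\Lambda]$, with inverse $p_1(\cdot)$. Each driver in service at $(l,m)$ completes the trip at rate $\mu_{l,m}$, where $\mu_{l,m}>0$ for $l\ge 1$ and $\mu_{l,m}\le\bar\mu$ for some constant $\bar\mu>0$. The base fare is $p_0\ge0$ and the mean on-trip time is $t_0>0$. The positive constants $w^d_s,w^d_o,w^r_p,w^r_q$ are the costs per unit time of a driver in service, an idle driver, a rider waiting for pick-up and a rider waiting in the queue. Put $c_d=w^d_s+w^r_p-w^d_o$ and $c_r=w^r_q$. A policy is a pair $(\lambda,\phi)$ with $\lambda:\mathcal S\to[0,\Lambda]$ (effective request rate) and $\phi:\mathcal S\to\{0,1\}$ ($1$ =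 dispatch, $0$ = hold), where $\phi(l,0)=0$ and $\phi(L,m)=0$ for all $l,m$. Whenever $\phi(l,m)=1$, the state moves instantly to $(l+1,m-1)$, and this is repeated until a state with $\phi=0$ is reached. In a state $(l,m)$ with $\phi(l,m)=0$, the state moves to $(l,m+1)$ at rate $\lambda(l,m)$ and to $(l-1,m)$ at rate $l\mu_{l,m}$, each move followed by the dispatches that $\phi$ prescribes. The net reward rate at $(l,m)$ is $\lambda(l,m)\bigl(p_0+w^r_pt_0+p_1(\lambda(l,m))\,t_0\bigr)-c_dl-c_rm$. A policy is *optimal* if, from every initial state, its long-run average expected net reward $\lim_{T\to\infty}\frac1T\mathbb E[\text{net reward on }[0,T]]$ exists and is at least the corresponding upper limit for every other policy. A state $(l,m)$ is of *type 1* if $l=L$, or $m=0$, or $l\mu_{l,m}>(l+1)\mu_{l+1,m-1}$; otherwise it is of *type 2*. A dispatching policy $\phi$ is *zigzag* if for each $l$ the sequence $(\phi(l,m))_{m\ge 0}$ is non-decreasing, and for each $m$ the sequence $(\phi(l,m))_{0\le l\le L}$ is non-increasing. **Theorem (optimal dispatching policy).** Assume diminishing returns on $\mathcal S$: (1) $l\mu_{l,m+1}-l\mu_{l,m}$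 is non-increasing in $m$ and non-decreasing in $l$; (2) $(l+1)\mu_{l+1,m}-l\mu_{l,m}$ is non-increasing in $l$ and non-decreasing in $m$. 1. If $c_d=c_r$, there is an optimal policy $(\lambda^*,\phi^*)$ with $\phi^*(l,m)=0$ at every type 1 state and $\phi^*(l,m)=1$ at every type 2 state; this $\phi^*$ is zigzag. 2. If $c_d>c_r$, there is an optimal policy $(\lambda^*,\phi^*)$ with $\phi^*(l,m)=0$ at every type 1 state. 3. If $0\le c_d<c_r$, there is an optimal policy $(\lambda^*,\phi^*)$ with $\phi^*(l,m)=1$ at every type 2 state. -/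

import Mathlib

noncomputable section

namespace SpatialQueue

open Set Filter Topology MeasureTheory ProbabilityTheory

/-- The data of the two-sided spatial queue. A state is a pair `(l, m)` with `l ≤ L` drivers in
service and `m` riders waiting in the queue; functions of the state are written as functions on
`ℕ × ℕ`, and only their values at `l ≤ L` matter. -/
structure Model where
  /-- number of drivers -/
  L : ℕ
  /-- rate of the Poisson stream of potential riders -/
  Lam : ℝ
  Lam_pos : 0 < Lam
  /-- service rate `μ_{l,m}` of each driver in service at state `(l, m)` -/
  mu : ℕ → ℕ → ℝ
  mu_pos : ∀ l m, 1 ≤ l → l ≤ L → 0 < mu l m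
  /-- uniform bound on the service rates -/
  muBar : ℝ
  muBar_pos : 0 < muBar
  mu_le : ∀ l m, l ≤ L → mu l m ≤ muBar
  /-- law of the riders' willingness to pay per kilometer -/
  wtp : Measure ℝ
  wtp_prob : IsProbabilityMeasure wtp
  /-- largest per-kilometer price -/
  pMax : ℝ
  tail_zero : 1 - cdf wtp 0 = 1
  tail_pMax : 1 - cdf wtp pMax = 0
  tail_strictAnti : StrictAntiOn (fun p => 1 - cdf wtp p) (Icc 0 pMax)
  /-- one-to-one correspondence between prices and effective request rates -/
  price_bij : BijOn (fun p => Lam * (1 - cdf wtp p)) (Icc 0 pMax) (Icc 0 Lam)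
  /-- fixed base fare -/
  p0 : ℝ
  p0_nonneg : 0 ≤ p0
  /-- mean on-trip time -/
  t0 : ℝ
  t0_pos : 0 < t0
  /-- cost per unit time of a driver in service -/
  wsd : ℝ
  wsd_pos : 0 < wsd
  /-- cost per unit time of an idle driver -/
  wod : ℝ
  wod_pos : 0 < wod
  /-- penalty per unit time of a rider waiting to be picked up -/
  wpr : ℝ
  wpr_pos : 0 < wpr
  /-- penalty per unit time of a rider waiting in the queue -/
  wqr : ℝ
  wqr_pos : 0 < wqr

namespace Model

variable (M : Model)

/-- Driver-side penalty coefficient `c_d`. -/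
def cd : ℝ := M.wsd + M.wpr - M.wod

/-- Rider-side penalty coefficient `c_r`. -/
def cr : ℝ := M.wqr

/-- Total trip completion rate `l * μ_{l,m}`. -/
def totalRate (l m : ℕ) : ℝ := (l : ℝ) * M.mu l m

/-- The per-kilometer price at which the effective request rate is `lam`. -/
def price (lam : ℝ) : ℝ :=
  Function.invFunOn (fun p => M.Lam * (1 - cdf M.wtp p)) (Icc 0 M.pMax) lam

/-- A clock rate that dominates the total transition rate at every state. -/
def clock : ℝ := M.Lam + M.L * M.muBar

/-- The diminishing-returns conditions on the total service rate. -/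
def DiminishingReturns : Prop :=
  ((∀ l ≤ M.L, Antitone fun m => M.totalRate l (m + 1) - M.totalRate l m) ∧
    (∀ m, MonotoneOn (fun l => M.totalRate l (m + 1) - M.totalRate l m) (Iic M.L))) ∧
  ((∀ m, AntitoneOn (fun l => M.totalRate (l + 1) m - M.totalRate l m) (Iio M.L)) ∧
    (∀ l < M.L, Monotone fun m => M.totalRate (l + 1) m - M.totalRate l m))

/-- Type 1 states: dispatching one driver is impossible or strictly lowers the total rate. -/
def IsType1 (l m : ℕ) : Prop :=
  l ≤ M.L ∧ (l = M.L ∨ m = 0 ∨ M.totalRate (l + 1) (m - 1) < M.totalRate l m)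

/-- Type 2 states: all the other states. -/
def IsType2 (l m : ℕ) : Prop :=
  l ≤ M.L ∧ ¬ M.IsType1 l m

end Model

/-- A policy: a pricing policy, given by the effective request rates, together with a dispatching
policy (`1` is dispatch, `0` is hold), which can only dispatch when there are an idle driver and a
waiting rider. -/
structure Policy (M : Model) where
  rate : ℕ → ℕ → ℝ
  rate_mem : ∀ l m, l ≤ M.L → rate l m ∈ Icc 0 M.Lam
  dispatch : ℕ → ℕ → Fin 2
  dispatch_no_rider : ∀ l, dispatch l 0 = 0
  dispatch_no_driver : ∀ m, dispatch M.L m = 0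

/-- The state reached from `(l, m)` by dispatching drivers one at a time until the dispatching
policy `φ` says hold. -/
def settle (φ : ℕ → ℕ → Fin 2) : ℕ → ℕ → ℕ × ℕ
  | l, 0 => (l, 0)
  | l, m + 1 => if φ l (m + 1) = 1 then settle φ (l + 1) m else (l, m + 1)

namespace Policy

variable {M : Model} (P : Policy M)

/-- One tick of the uniformized chain, acting on functions of the state: at state `(l, m)` a rider
joins at rate `λ(l, m)`, a trip is completed at rate `l * μ_{l,m}`, each followed by the
dispatches that the policy prescribes. -/
def step (f : ℕ × ℕ → ℝ) (x : ℕ × ℕ) : ℝ :=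
  f x + P.rate x.1 x.2 / M.clock * (f (settle P.dispatch x.1 (x.2 + 1)) - f x)
    + M.totalRate x.1 x.2 / M.clock * (f (settle P.dispatch (x.1 - 1) x.2) - f x)

/-- `E_x[f(X_t)]` for the continuous-time Markov chain `X` controlled by the policy: the number of
ticks up to time `t` is Poisson with mean `clock * t`. -/
def expect (f : ℕ × ℕ → ℝ) (t : ℝ) (x : ℕ × ℕ) : ℝ :=
  ∑' k : ℕ, Real.exp (-(M.clock * t)) * (M.clock * t) ^ k / (k.factorial : ℝ) * (P.step^[k] f) x

/-- Net reward rate at a state: revenue rate minus driver-side and rider-side penalty rates. -/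
def reward (x : ℕ × ℕ) : ℝ :=
  P.rate x.1 x.2 * (M.p0 + M.wpr * M.t0 + M.price (P.rate x.1 x.2) * M.t0)
    - M.cd * x.1 - M.cr * x.2

/-- Expected net reward per unit time over `[0, T]` when the system is started at `(l, m)`
(and the dispatches prescribed there are carried out at once). -/
def avgReward (T : ℝ) (l m : ℕ) : ℝ :=
  (∫ t in (0 : ℝ)..T, P.expect P.reward t (settle P.dispatch l m)) / T

/-- A policy is optimal if from every initial state its long-run average net reward exists and is
at least the (upper) long-run average net reward of every other policy. -/
def IsOptimal : Prop :=
  ∃ g : ℕ → ℕ → ℝ, ∀ l m, l ≤ M.L →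
    Tendsto (fun T => P.avgReward T l m) atTop (𝓝 (g l m)) ∧
    ∀ Q : Policy M, limsup (fun T => ((Q.avgReward T l m : ℝ) : EReal)) atTop ≤ (g l m : EReal)

/-- Zigzag dispatching: each row `φ(l, ·)` consists of `0`s followed by `1`s, and each column
`φ(·, m)` of `1`s followed by `0`s. -/
def IsZigzag : Prop :=
  (∀ l ≤ M.L, Monotone fun m => P.dispatch l m) ∧
  (∀ m, AntitoneOn (fun l => P.dispatch l m) (Iic M.L))

end Policy

end SpatialQueue

end

/-!
In the discounted problem with truncated costs, value iteration preserves three comparisons: values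
decrease in the number of drivers in service, a dispatch at a type 2 state is no loss if
`c_d ≤ c_r`, and holding at a type 1 state is no loss if `c_r ≤ c_d`. By diminishing returns the
type 2 region has a zigzag shape, and then the comparisons at a state follow from those at its
neighbours. The differences of discounted values are bounded uniformly in the discount
rate, because an idle platform can be brought to any state, and any state emptied, at bounded cost.
Hence their limit along an ultrafilter solves the average reward optimality equation and inherits
the comparisons. A policy that is greedy for the limit earns the optimal gain, and no policy earns
more, since the drift of a discounted value bounds the average reward of every policy. Without
drivers there is nothing to empty the queue, and turning every rider away is optimal.
-/

open Set Filter Topology MeasureTheory ProbabilityTheory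

noncomputable section

namespace SpatialQueue

/-! ### Poisson means -/

section PoissonMean

/-- At most exponential growth of a sequence, which makes its exponential generating series
`∑ aₖ sᵏ / k!` entire. -/
def HasExpGrowth (a : ℕ → ℝ) : Prop := ∃ A B : ℝ, 0 ≤ B ∧ ∀ k, |a k| ≤ A * B ^ k

/-- The mean of `a N` for a Poisson variable `N` with mean `s`. -/
def poissonMean (a : ℕ → ℝ) (s : ℝ) : ℝ :=
  ∑' k : ℕ, Real.exp (-s) * s ^ k / (k.factorial : ℝ) * a k

variable {a b : ℕ → ℝ}

theorem hasExpGrowth_const (c : ℝ) : HasExpGrowth fun _ => c :=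
  ⟨|c|, 1, zero_le_one, fun k => by simp⟩

namespace HasExpGrowth

theorem sub (ha : HasExpGrowth a) (hb : HasExpGrowth b) : HasExpGrowth fun k => a k - b k := by
  obtain ⟨A, B, hB, ha⟩ := ha
  obtain ⟨A', B', hB', hb⟩ := hb
  have hA : 0 ≤ A := by simpa using (abs_nonneg _).trans (ha 0)
  have hA' : 0 ≤ A' := by simpa using (abs_nonneg _).trans (hb 0)
  refine ⟨A + A', max B B', le_max_of_le_left hB, fun k => ?_⟩
  calc |a k - b k| ≤ A * B ^ k + A' * B' ^ k := (abs_sub _ _).trans (add_le_add (ha k) (hb k))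
    _ ≤ A * max B B' ^ k + A' * max B B' ^ k := by
        gcongr
        · exact le_max_left _ _
        · exact le_max_right _ _
    _ = (A + A') * max B B' ^ k := by ring

theorem shift (ha : HasExpGrowth a) : HasExpGrowth fun k => a (k + 1) := by
  obtain ⟨A, B, hB, ha⟩ := ha
  exact ⟨A * B, B, hB, fun k => (ha (k + 1)).trans_eq (by ring)⟩

theorem partialSum (ha : HasExpGrowth a) :
    HasExpGrowth fun k => ∑ j ∈ Finset.range k, a j := by
  obtain ⟨A, B, hB, ha⟩ := ha
  have hA : 0 ≤ A := by simpa using (abs_nonneg _).trans (ha 0)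
  refine ⟨A, B + 2, by linarith, fun k => ?_⟩
  induction k with
  | zero => simpa using hA
  | succ k ih =>
    have hpow : B ^ k ≤ (B + 2) ^ k := by gcongr; linarith
    calc |∑ j ∈ Finset.range (k + 1), a j| ≤ A * (B + 2) ^ k + A * B ^ k := by
          rw [Finset.sum_range_succ]
          exact (abs_add_le _ _).trans (add_le_add ih (ha k))
      _ ≤ A * (B + 2) ^ k + A * (B + 2) ^ k := by gcongr
      _ ≤ A * (B + 2) ^ (k + 1) := by
          have := mul_nonneg hB (mul_nonneg hA (pow_nonneg (by linarith : 0 ≤ B + 2) k))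
          rw [pow_succ]
          linarith

theorem summable (ha : HasExpGrowth a) (s : ℝ) :
    Summable fun k : ℕ => s ^ k / (k.factorial : ℝ) * a k := by
  obtain ⟨A, B, -, ha⟩ := ha
  refine .of_norm_bounded ((Real.summable_pow_div_factorial (|s| * B)).mul_left A) fun k => ?_
  rw [Real.norm_eq_abs, abs_mul, abs_div, abs_pow, Nat.abs_cast, mul_pow]
  calc |s| ^ k / (k.factorial : ℝ) * |a k| ≤ |s| ^ k / (k.factorial : ℝ) * (A * B ^ k) := by
        gcongr; exact ha k
    _ = A * (|s| ^ k * B ^ k / (k.factorial : ℝ)) := by ring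

theorem summable_poisson (ha : HasExpGrowth a) (s : ℝ) :
    Summable fun k : ℕ => Real.exp (-s) * s ^ k / (k.factorial : ℝ) * a k :=
  ((ha.summable s).mul_left (Real.exp (-s))).congr fun k => by ring

theorem hasDerivAt_tsum (ha : HasExpGrowth a) (s : ℝ) :
    HasDerivAt (fun s : ℝ => ∑' k : ℕ, s ^ k / (k.factorial : ℝ) * a k)
      (∑' k : ℕ, s ^ k / (k.factorial : ℝ) * a (k + 1)) s := by
  have htail (y : ℝ) : ∑' k : ℕ, y ^ k / (k.factorial : ℝ) * a k
      = a 0 + ∑' k : ℕ, y ^ (k + 1) / ((k + 1).factorial : ℝ) * a (k + 1) := by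
    rw [(ha.summable y).tsum_eq_zero_add]
    simp
  have hterm (k : ℕ) (y : ℝ) :
      HasDerivAt (fun y : ℝ => y ^ (k + 1) / ((k + 1).factorial : ℝ) * a (k + 1))
        (y ^ k / (k.factorial : ℝ) * a (k + 1)) y := by
    refine (((hasDerivAt_pow (k + 1) y).div_const _).mul_const _).congr_deriv ?_
    have : (k.factorial : ℝ) ≠ 0 := by positivity
    rw [Nat.factorial_succ, Nat.add_sub_cancel]
    push_cast
    field_simp
  obtain ⟨A, B, -, hshift⟩ := ha.shift
  have hbound (k : ℕ) (y : ℝ) (hy : y ∈ Metric.ball 0 (|s| + 1)) :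
      ‖y ^ k / (k.factorial : ℝ) * a (k + 1)‖
        ≤ A * (((|s| + 1) * B) ^ k / (k.factorial : ℝ)) := by
    have hy' : |y| ≤ |s| + 1 := (mem_ball_zero_iff.1 hy).le
    rw [Real.norm_eq_abs, abs_mul, abs_div, abs_pow, Nat.abs_cast]
    calc |y| ^ k / (k.factorial : ℝ) * |a (k + 1)|
        ≤ (|s| + 1) ^ k / (k.factorial : ℝ) * (A * B ^ k) := by gcongr; exact hshift k
      _ = A * (((|s| + 1) * B) ^ k / (k.factorial : ℝ)) := by rw [mul_pow]; ring
  have hs : s ∈ Metric.ball 0 (|s| + 1) := by simp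
  simp_rw [htail]
  exact (hasDerivAt_tsum_of_isPreconnected
    ((Real.summable_pow_div_factorial ((|s| + 1) * B)).mul_left A) Metric.isOpen_ball
    (convex_ball _ _).isPreconnected (fun k y _ => hterm k y) hbound hs
    ((summable_nat_add_iff 1).2 (ha.summable s)) hs).const_add _

end HasExpGrowth

theorem poissonMean_eq (a : ℕ → ℝ) (s : ℝ) :
    poissonMean a s = Real.exp (-s) * ∑' k : ℕ, s ^ k / (k.factorial : ℝ) * a k := by
  rw [poissonMean, ← tsum_mul_left]
  exact tsum_congr fun k => by ring

theorem poissonMean_const (c s : ℝ) : poissonMean (fun _ => c) s = c := by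
  have hexp : ∑' k : ℕ, s ^ k / (k.factorial : ℝ) = Real.exp s := by
    rw [Real.exp_eq_exp_ℝ]
    exact (NormedSpace.expSeries_div_hasSum_exp s).tsum_eq
  rw [poissonMean_eq, tsum_mul_right, hexp, ← mul_assoc, ← Real.exp_add, neg_add_cancel,
    Real.exp_zero, one_mul]

theorem poissonMean_neg (a : ℕ → ℝ) (s : ℝ) :
    poissonMean (fun k => -a k) s = -poissonMean a s := by
  simp only [poissonMean, mul_neg, tsum_neg]

theorem poissonMean_sub (ha : HasExpGrowth a) (hb : HasExpGrowth b) (s : ℝ) :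
    poissonMean (fun k => a k - b k) s = poissonMean a s - poissonMean b s := by
  simp only [poissonMean, mul_sub]
  exact (ha.summable_poisson s).tsum_sub (hb.summable_poisson s)

theorem poissonMean_mono (ha : HasExpGrowth a) (hb : HasExpGrowth b) (h : ∀ k, a k ≤ b k) {s : ℝ}
    (hs : 0 ≤ s) : poissonMean a s ≤ poissonMean b s :=
  (ha.summable_poisson s).tsum_le_tsum (fun k => mul_le_mul_of_nonneg_left (h k) (by positivity))
    (hb.summable_poisson s)

theorem hasDerivAt_poissonMean (ha : HasExpGrowth a) (s : ℝ) :
    HasDerivAt (poissonMean a) (poissonMean (fun k => a (k + 1) - a k) s) s := by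
  have hexp : HasDerivAt (fun s => Real.exp (-s)) (-Real.exp (-s)) s := by
    simpa using (hasDerivAt_neg s).exp
  rw [funext (poissonMean_eq a), poissonMean_sub ha.shift ha, poissonMean_eq, poissonMean_eq]
  exact (hexp.mul (ha.hasDerivAt_tsum s)).congr_deriv (by ring)

theorem continuous_poissonMean (ha : HasExpGrowth a) : Continuous (poissonMean a) :=
  continuous_iff_continuousAt.2 fun s => (hasDerivAt_poissonMean ha s).continuousAt

theorem integral_poissonMean (ha : HasExpGrowth a) (s : ℝ) :
    ∫ t in (0 : ℝ)..s, poissonMean a t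
      = poissonMean (fun k => ∑ j ∈ Finset.range k, a j) s := by
  have hderiv (t : ℝ) : HasDerivAt (poissonMean fun k => ∑ j ∈ Finset.range k, a j)
      (poissonMean a t) t := by
    simpa only [Finset.sum_range_succ_sub_sum] using hasDerivAt_poissonMean ha.partialSum t
  have hzero : poissonMean (fun k => ∑ j ∈ Finset.range k, a j) 0 = 0 := by
    rw [poissonMean, tsum_eq_single 0 fun k hk => by simp [hk]]
    simp
  rw [intervalIntegral.integral_eq_sub_of_hasDerivAt (fun t _ => hderiv t)
    ((continuous_poissonMean ha).intervalIntegrable _ _), hzero, sub_zero]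

theorem integral_poissonMean_le (ha : HasExpGrowth a) {g C : ℝ}
    (h : ∀ k : ℕ, ∑ j ∈ Finset.range k, a j ≤ g * k + C) {s : ℝ} (hs : 0 ≤ s) :
    ∫ t in (0 : ℝ)..s, poissonMean a t ≤ g * s + C := by
  have hag := ha.sub (hasExpGrowth_const g)
  have hcentered : ∫ t in (0 : ℝ)..s, poissonMean (fun k => a k - g) t
      = (∫ t in (0 : ℝ)..s, poissonMean a t) - g * s := by
    simp_rw [poissonMean_sub ha (hasExpGrowth_const g), poissonMean_const]
    rw [intervalIntegral.integral_sub ((continuous_poissonMean ha).intervalIntegrable _ _)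
      intervalIntegrable_const, intervalIntegral.integral_const, sub_zero, smul_eq_mul, mul_comm]
  have hle : poissonMean (fun k => ∑ j ∈ Finset.range k, (a j - g)) s ≤ C := by
    refine (poissonMean_mono hag.partialSum (hasExpGrowth_const C) (fun k => ?_) hs).trans_eq
      (poissonMean_const C s)
    rw [Finset.sum_sub_distrib, Finset.sum_const, Finset.card_range, nsmul_eq_mul]
    linarith [h k]
  rw [← integral_poissonMean hag, hcentered] at hle
  linarith

end PoissonMean

namespace Model

variable (M : Model)

/-! ### Service rates and the shape of the type 2 region -/

section Rates

variable {M}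

/-- The bound `L * μ̄` on the total trip completion rates. -/
def maxTotalRate (M : Model) : ℝ := M.L * M.muBar

theorem clock_eq (M : Model) : M.clock = M.Lam + M.maxTotalRate := rfl

theorem maxTotalRate_nonneg (M : Model) : 0 ≤ M.maxTotalRate :=
  mul_nonneg M.L.cast_nonneg M.muBar_pos.le

theorem clock_pos (M : Model) : 0 < M.clock :=
  add_pos_of_pos_of_nonneg M.Lam_pos M.maxTotalRate_nonneg

theorem totalRate_zero_left (M : Model) (m : ℕ) : M.totalRate 0 m = 0 := by
  simp [totalRate]

theorem totalRate_pos {l : ℕ} (hl : l ≠ 0) (hL : l ≤ M.L) (m : ℕ) : 0 < M.totalRate l m :=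
  mul_pos (by positivity) (M.mu_pos l m (Nat.one_le_iff_ne_zero.2 hl) hL)

theorem totalRate_nonneg {l : ℕ} (hL : l ≤ M.L) (m : ℕ) : 0 ≤ M.totalRate l m := by
  rcases eq_or_ne l 0 with rfl | hl
  · exact (M.totalRate_zero_left m).ge
  · exact (totalRate_pos hl hL m).le

theorem totalRate_le {l : ℕ} (hL : l ≤ M.L) (m : ℕ) : M.totalRate l m ≤ M.maxTotalRate :=
  calc M.totalRate l m ≤ l * M.muBar := by
        unfold totalRate; gcongr; exact M.mu_le l m hL
    _ ≤ M.maxTotalRate := by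
        unfold maxTotalRate; gcongr; exact M.muBar_pos.le

theorem isType2_succ_iff {l m : ℕ} :
    M.IsType2 l (m + 1) ↔ l < M.L ∧ M.totalRate l (m + 1) ≤ M.totalRate (l + 1) m := by
  simp only [IsType2, IsType1, Nat.add_sub_cancel, Nat.succ_ne_zero, false_or, not_and, not_or,
    not_lt]
  refine ⟨fun ⟨hl, h⟩ => ?_, fun ⟨hl, h⟩ => ⟨hl.le, fun _ => ⟨hl.ne, h⟩⟩⟩
  exact ⟨lt_of_le_of_ne hl (h hl).1, (h hl).2⟩

theorem IsType2.pos {l m : ℕ} (h : M.IsType2 l m) : 0 < m :=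
  Nat.pos_of_ne_zero fun hm => h.2 ⟨h.1, Or.inr (Or.inl hm)⟩

theorem IsType2.lt {l m : ℕ} (h : M.IsType2 l m) : l < M.L :=
  lt_of_le_of_ne h.1 fun hl => h.2 ⟨h.1, Or.inl hl⟩

variable (M) in
/-- The type 2 region is the dispatching region of a zigzag policy: it is closed under adding a
waiting rider and under freeing a driver. -/
structure ZigzagType2 : Prop where
  succ_right {l m : ℕ} : M.IsType2 l m → M.IsType2 l (m + 1)
  of_succ_left {l m : ℕ} : M.IsType2 (l + 1) m → M.IsType2 l m

/-- The change of the total service rate caused by dispatching one driver at `(l, m + 1)`. -/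
def dispatchGain (M : Model) (l m : ℕ) : ℝ := M.totalRate (l + 1) m - M.totalRate l (m + 1)

theorem DiminishingReturns.dispatchGain_le_succ_right (h : M.DiminishingReturns) {l : ℕ}
    (hl : l < M.L) (m : ℕ) : M.dispatchGain l m ≤ M.dispatchGain l (m + 1) := by
  have h₁ := h.1.1 l hl.le m.le_succ
  have h₂ := h.2.2 l hl m.le_succ
  simp only [dispatchGain] at *
  linarith

theorem DiminishingReturns.dispatchGain_succ_left_le (h : M.DiminishingReturns) {l : ℕ}
    (hl : l + 1 < M.L) (m : ℕ) : M.dispatchGain (l + 1) m ≤ M.dispatchGain l m := by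
  have hl' : l < M.L := l.lt_succ_self.trans hl
  have h₁ := h.1.2 m (mem_Iic.2 hl'.le) (mem_Iic.2 hl.le) l.le_succ
  have h₂ := h.2.1 m (mem_Iio.2 hl') (mem_Iio.2 hl) l.le_succ
  simp only [dispatchGain] at *
  linarith

theorem DiminishingReturns.zigzagType2 (h : M.DiminishingReturns) : M.ZigzagType2 where
  succ_right {l m} h₂ := by
    obtain ⟨m, rfl⟩ := Nat.exists_eq_add_one.2 h₂.pos
    rw [isType2_succ_iff] at h₂ ⊢
    have := h.dispatchGain_le_succ_right h₂.1 m
    simp only [dispatchGain] at this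
    exact ⟨h₂.1, by linarith⟩
  of_succ_left {l m} h₂ := by
    obtain ⟨m, rfl⟩ := Nat.exists_eq_add_one.2 h₂.pos
    rw [isType2_succ_iff] at h₂ ⊢
    have := h.dispatchGain_succ_left_le h₂.1 m
    simp only [dispatchGain] at this
    exact ⟨l.lt_succ_self.trans h₂.1, by linarith⟩

end Rates

end Model

namespace Policy

variable {M : Model} (P : Policy M)

/-! ### The uniformized chain -/

section Step

theorem lt_of_dispatch {l m : ℕ} (hl : l ≤ M.L) (h : P.dispatch l m = 1) : l < M.L := by
  refine lt_of_le_of_ne hl fun hL => ?_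
  rw [hL, P.dispatch_no_driver] at h
  exact absurd h (by decide)

theorem settle_fst_add_snd (φ : ℕ → ℕ → Fin 2) (l m : ℕ) :
    (settle φ l m).1 + (settle φ l m).2 = l + m := by
  induction m generalizing l with
  | zero => rfl
  | succ m ih =>
    unfold settle
    split_ifs
    · rw [ih]; ring
    · rfl

theorem apply_settle_le {f : ℕ × ℕ → ℝ}
    (hf : ∀ l m, l < M.L → P.dispatch l (m + 1) = 1 → f (l + 1, m) ≤ f (l, m + 1)) {l m : ℕ}
    (hl : l ≤ M.L) : f (settle P.dispatch l m) ≤ f (l, m) := by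
  induction m generalizing l with
  | zero => rfl
  | succ m ih =>
    unfold settle
    split_ifs with h
    · have hlt := P.lt_of_dispatch hl h
      exact (ih hlt).trans (hf l m hlt h)
    · rfl

theorem apply_settle_eq {f : ℕ × ℕ → ℝ}
    (hf : ∀ l m, l < M.L → P.dispatch l (m + 1) = 1 → f (l + 1, m) = f (l, m + 1)) {l m : ℕ}
    (hl : l ≤ M.L) : f (settle P.dispatch l m) = f (l, m) :=
  le_antisymm (P.apply_settle_le (fun l m h h' => (hf l m h h').le) hl) <| neg_le_neg_iff.1 <|
    P.apply_settle_le (f := fun x => -f x) (fun l m h h' => neg_le_neg (hf l m h h').ge) hl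

/-- The states in which the chain spends time: those where the policy holds. -/
def settledStates : Set (ℕ × ℕ) := {x | x.1 ≤ M.L ∧ P.dispatch x.1 x.2 = 0}

theorem settle_mem_settledStates {l m : ℕ} (hl : l ≤ M.L) :
    settle P.dispatch l m ∈ P.settledStates := by
  induction m generalizing l with
  | zero => exact ⟨hl, P.dispatch_no_rider l⟩
  | succ m ih =>
    unfold settle
    split_ifs with h
    · exact ih (P.lt_of_dispatch hl h)
    · exact ⟨hl, by_contra fun h' => h (Fin.eq_one_of_ne_zero _ h')⟩

/-- A set of states that the chain controlled by the policy never leaves. -/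
structure IsInvariant (S : Set (ℕ × ℕ)) : Prop where
  le_L {x} : x ∈ S → x.1 ≤ M.L
  arrival {x} : x ∈ S → P.rate x.1 x.2 ≠ 0 → settle P.dispatch x.1 (x.2 + 1) ∈ S
  completion {x} : x ∈ S → M.totalRate x.1 x.2 ≠ 0 → settle P.dispatch (x.1 - 1) x.2 ∈ S

theorem isInvariant_settledStates : P.IsInvariant P.settledStates where
  le_L hx := hx.1
  arrival hx _ := P.settle_mem_settledStates hx.1
  completion hx _ := P.settle_mem_settledStates ((Nat.sub_le _ _).trans hx.1)

theorem step_eq (f : ℕ × ℕ → ℝ) (x : ℕ × ℕ) :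
    P.step f x = (1 - P.rate x.1 x.2 / M.clock - M.totalRate x.1 x.2 / M.clock) * f x
      + P.rate x.1 x.2 / M.clock * f (settle P.dispatch x.1 (x.2 + 1))
      + M.totalRate x.1 x.2 / M.clock * f (settle P.dispatch (x.1 - 1) x.2) := by
  unfold step
  ring

theorem clock_mul_step_sub (f : ℕ × ℕ → ℝ) (x : ℕ × ℕ) :
    M.clock * (P.step f x - f x)
      = P.rate x.1 x.2 * (f (settle P.dispatch x.1 (x.2 + 1)) - f x)
        + M.totalRate x.1 x.2 * (f (settle P.dispatch (x.1 - 1) x.2) - f x) := by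
  have := M.clock_pos.ne'
  unfold step
  field_simp
  ring

theorem stay_prob_nonneg {l : ℕ} (hl : l ≤ M.L) (m : ℕ) :
    0 ≤ 1 - P.rate l m / M.clock - M.totalRate l m / M.clock := by
  rw [sub_sub, ← add_div, sub_nonneg, div_le_one M.clock_pos]
  exact add_le_add (P.rate_mem l m hl).2 (Model.totalRate_le hl m)

variable {P} {S : Set (ℕ × ℕ)} {f u v : ℕ × ℕ → ℝ}

theorem step_le_step (hS : P.IsInvariant S) (h : ∀ x ∈ S, u x ≤ v x) :
    ∀ x ∈ S, P.step u x ≤ P.step v x := by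
  intro x hx
  have hl := hS.le_L hx
  have hweight {r a b : ℝ} (hr : 0 ≤ r) (hab : r ≠ 0 → a ≤ b) :
      r / M.clock * a ≤ r / M.clock * b := by
    rcases hr.eq_or_lt with rfl | hr
    · simp
    · exact mul_le_mul_of_nonneg_left (hab hr.ne') (div_nonneg hr.le M.clock_pos.le)
  rw [step_eq, step_eq]
  exact add_le_add_three (mul_le_mul_of_nonneg_left (h x hx) (P.stay_prob_nonneg hl x.2))
    (hweight (P.rate_mem _ _ hl).1 fun hr => h _ (hS.arrival hx hr))
    (hweight (Model.totalRate_nonneg hl _) fun hr => h _ (hS.completion hx hr))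

theorem step_const (c : ℝ) : P.step (fun _ => c) = fun _ => c := by
  ext x
  simp [step]

theorem step_neg (f : ℕ × ℕ → ℝ) : P.step (fun x => -f x) = fun x => -P.step f x := by
  ext x
  simp only [step]
  ring

theorem step_add_mul_sub (f u v : ℕ × ℕ → ℝ) (c : ℝ) :
    P.step (fun x => f x + c * (u x - v x)) =
      fun x => P.step f x + c * (P.step u x - P.step v x) := by
  ext x
  simp only [step]
  ring

theorem iterate_step_neg (f : ℕ × ℕ → ℝ) (k : ℕ) :
    P.step^[k] (fun x => -f x) = fun x => -P.step^[k] f x := by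
  induction k generalizing f with
  | zero => rfl
  | succ k ih => rw [Function.iterate_succ_apply, step_neg, ih, ← Function.iterate_succ_apply]

theorem le_iterate_step (hS : P.IsInvariant S) {B : ℝ} (h : ∀ x ∈ S, B ≤ u x) (k : ℕ) :
    ∀ x ∈ S, B ≤ P.step^[k] u x := by
  induction k with
  | zero => exact h
  | succ k ih =>
    rw [Function.iterate_succ_apply']
    simpa only [step_const] using step_le_step (u := fun _ => B) hS ih

theorem iterate_step_drift_le (hS : P.IsInvariant S) {g : ℝ}
    (h : ∀ x ∈ S, f x + M.clock * (P.step u x - u x) ≤ g) (k : ℕ) :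
    ∀ x ∈ S, P.step^[k] f x + M.clock * (P.step^[k + 1] u x - P.step^[k] u x) ≤ g := by
  induction k generalizing f u with
  | zero => exact h
  | succ _ ih =>
    refine ih (f := P.step f) (u := P.step u) ?_
    simpa only [step_const, step_add_mul_sub] using step_le_step (v := fun _ => g) hS h

theorem sum_iterate_step_le (hS : P.IsInvariant S) {g B : ℝ}
    (h : ∀ x ∈ S, f x + M.clock * (P.step u x - u x) ≤ g) (hB : ∀ x ∈ S, B ≤ u x) {x : ℕ × ℕ}
    (hx : x ∈ S) (k : ℕ) :
    ∑ j ∈ Finset.range k, P.step^[j] f x ≤ g * k + M.clock * (u x - B) := by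
  have htelescope : ∑ j ∈ Finset.range k,
      (P.step^[j] f x + M.clock * (P.step^[j + 1] u x - P.step^[j] u x)) ≤ k * g := by
    simpa using Finset.sum_le_card_nsmul (Finset.range k) _ g
      fun j _ => iterate_step_drift_le hS h j x hx
  rw [Finset.sum_add_distrib, ← Finset.mul_sum, Finset.sum_range_sub fun j => P.step^[j] u x,
    Function.iterate_zero_apply] at htelescope
  nlinarith [M.clock_pos, le_iterate_step hS hB k x hx]

/-- The total number of riders in the system, plus one: a weight that at most doubles at a tick. -/
def load (x : ℕ × ℕ) : ℝ := x.1 + x.2 + 1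

theorem step_load_le {x : ℕ × ℕ} (hl : x.1 ≤ M.L) : P.step load x ≤ 2 * load x := by
  have hsettle (l m : ℕ) : load (settle P.dispatch l m) = l + m + 1 := by
    unfold load
    exact_mod_cast congrArg (· + 1) (settle_fst_add_snd P.dispatch l m)
  have hload : 1 ≤ load x := by simp [load, add_nonneg]
  have harrival : load (settle P.dispatch x.1 (x.2 + 1)) - load x = 1 := by
    rw [hsettle, load]; push_cast; ring
  have hcompletion : load (settle P.dispatch (x.1 - 1) x.2) - load x ≤ 0 := by
    have : ((x.1 - 1 : ℕ) : ℝ) ≤ x.1 := by exact_mod_cast Nat.sub_le _ _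
    rw [hsettle, load]; linarith
  have hdrift : M.clock * (P.step load x - load x) ≤ M.clock * load x := by
    rw [clock_mul_step_sub, harrival, mul_one]
    nlinarith [(P.rate_mem x.1 x.2 hl).2, M.maxTotalRate_nonneg, M.clock_eq, M.clock_pos,
      mul_nonpos_of_nonneg_of_nonpos (Model.totalRate_nonneg hl x.2) hcompletion]
  linarith [le_of_mul_le_mul_left hdrift M.clock_pos]

theorem step_le_two_mul_load (hS : P.IsInvariant S) {A : ℝ} (hA : 0 ≤ A)
    (hf : ∀ x ∈ S, f x ≤ A * load x) : ∀ x ∈ S, P.step f x ≤ 2 * A * load x := by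
  intro x hx
  have hmul : P.step (fun x => A * load x) x = A * P.step load x := by
    simp only [step]
    ring
  calc P.step f x ≤ A * P.step load x := hmul ▸ step_le_step hS hf x hx
    _ ≤ A * (2 * load x) := by gcongr; exact step_load_le (hS.le_L hx)
    _ = 2 * A * load x := by ring

theorem abs_iterate_step_le (hS : P.IsInvariant S) {A : ℝ} (hA : 0 ≤ A)
    (hf : ∀ x ∈ S, |f x| ≤ A * load x) (k : ℕ) :
    ∀ x ∈ S, |P.step^[k] f x| ≤ 2 ^ k * A * load x := by
  induction k with
  | zero => simpa using hf
  | succ k ih =>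
    intro x hx
    have hA' : 0 ≤ 2 ^ k * A := by positivity
    rw [Function.iterate_succ_apply', pow_succ', mul_assoc 2]
    refine abs_le'.2 ⟨step_le_two_mul_load hS hA' (fun y hy => (abs_le'.1 (ih y hy)).1) x hx, ?_⟩
    have := step_le_two_mul_load hS hA' (fun y hy => (abs_le'.1 (ih y hy)).2) x hx
    rwa [step_neg] at this

theorem hasExpGrowth_iterate_step (hS : P.IsInvariant S) {A : ℝ} (hA : 0 ≤ A)
    (hf : ∀ x ∈ S, |f x| ≤ A * load x) {x : ℕ × ℕ} (hx : x ∈ S) :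
    HasExpGrowth fun k => P.step^[k] f x :=
  ⟨A * load x, 2, zero_le_two, fun k =>
    (abs_iterate_step_le hS hA hf k x hx).trans_eq (by ring)⟩

theorem integral_expect_eq (f : ℕ × ℕ → ℝ) (T : ℝ) (x : ℕ × ℕ) :
    ∫ t in (0 : ℝ)..T, P.expect f t x
      = M.clock⁻¹ * ∫ s in (0 : ℝ)..M.clock * T, poissonMean (fun k => P.step^[k] f x) s := by
  have := intervalIntegral.integral_comp_mul_left (a := 0) (b := T)
    (poissonMean fun k => P.step^[k] f x) M.clock_pos.ne'
  rwa [mul_zero, smul_eq_mul] at this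

/-- Only the telescoped sum of the drift inequality is taken under the Poisson mean, so that `u`
itself needs no growth bound. -/
theorem integral_expect_le (hS : P.IsInvariant S) {A g B : ℝ} (hA : 0 ≤ A)
    (hf : ∀ x ∈ S, |f x| ≤ A * load x)
    (h : ∀ x ∈ S, f x + M.clock * (P.step u x - u x) ≤ g) (hB : ∀ x ∈ S, B ≤ u x) {x : ℕ × ℕ}
    (hx : x ∈ S) {T : ℝ} (hT : 0 ≤ T) :
    ∫ t in (0 : ℝ)..T, P.expect f t x ≤ g * T + (u x - B) := by
  have hc := M.clock_pos
  rw [integral_expect_eq, inv_mul_le_iff₀ hc]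
  exact (integral_poissonMean_le (hasExpGrowth_iterate_step hS hA hf hx)
    (sum_iterate_step_le hS h hB hx) (by positivity)).trans_eq (by ring)

theorem le_integral_expect (hS : P.IsInvariant S) {A g B : ℝ} (hA : 0 ≤ A)
    (hf : ∀ x ∈ S, |f x| ≤ A * load x)
    (h : ∀ x ∈ S, g ≤ f x + M.clock * (P.step u x - u x)) (hB : ∀ x ∈ S, u x ≤ B) {x : ℕ × ℕ}
    (hx : x ∈ S) {T : ℝ} (hT : 0 ≤ T) :
    g * T + (u x - B) ≤ ∫ t in (0 : ℝ)..T, P.expect f t x := by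
  have hneg : ∫ t in (0 : ℝ)..T, P.expect (fun x => -f x) t x
      = -∫ t in (0 : ℝ)..T, P.expect f t x := by
    simp only [integral_expect_eq, iterate_step_neg, poissonMean_neg,
      intervalIntegral.integral_neg, mul_neg]
  have hdrift : ∀ x ∈ S, -f x + M.clock * (P.step (fun x => -u x) x - -u x) ≤ -g := by
    intro x hx
    rw [step_neg]
    linarith [h x hx]
  have := integral_expect_le hS hA (fun x hx => (abs_neg (f x)).trans_le (hf x hx)) hdrift
    (fun x hx => neg_le_neg (hB x hx)) hx hT
  rw [hneg] at this
  linarith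

end Step

end Policy

namespace Model

variable (M : Model)

/-! ### Revenue and pricing -/

section Pricing

theorem price_mem {x : ℝ} (hx : x ∈ Icc 0 M.Lam) : M.price x ∈ Icc 0 M.pMax :=
  Function.invFunOn_mem (M.price_bij.surjOn hx)

theorem Lam_mul_tail_price {x : ℝ} (hx : x ∈ Icc 0 M.Lam) :
    M.Lam * (1 - cdf M.wtp (M.price x)) = x :=
  Function.invFunOn_eq (f := fun p => M.Lam * (1 - cdf M.wtp p)) (M.price_bij.surjOn hx)

theorem price_Lam_mul_tail {p : ℝ} (hp : p ∈ Icc 0 M.pMax) :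
    M.price (M.Lam * (1 - cdf M.wtp p)) = p :=
  M.price_bij.injOn (M.price_mem (M.price_bij.mapsTo hp)) hp
    (M.Lam_mul_tail_price (M.price_bij.mapsTo hp))

theorem antitoneOn_price : AntitoneOn M.price (Icc 0 M.Lam) := by
  intro x hx y hy hxy
  by_contra! h
  have := mul_lt_mul_of_pos_left (M.tail_strictAnti (M.price_mem hx) (M.price_mem hy) h) M.Lam_pos
  simp only [M.Lam_mul_tail_price hx, M.Lam_mul_tail_price hy] at this
  linarith

/-- A monotone surjection between orders with their order topologies is continuous. -/
theorem continuousOn_price : ContinuousOn M.price (Icc 0 M.Lam) := by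
  let f : Icc 0 M.Lam → (Icc 0 M.pMax)ᵒᵈ :=
    fun x => OrderDual.toDual ⟨M.price x, M.price_mem x.2⟩
  have hmono : Monotone f := fun x y hxy => M.antitoneOn_price x.2 y.2 hxy
  have hsurj : Function.Surjective f := fun p =>
    ⟨⟨_, M.price_bij.mapsTo (OrderDual.ofDual p).2⟩,
      Subtype.ext (M.price_Lam_mul_tail (OrderDual.ofDual p).2)⟩
  rw [continuousOn_iff_continuous_domRestrict]
  exact continuous_subtype_val.comp
    (continuous_ofDual.comp (hmono.continuous_of_surjective hsurj))

/-- Revenue rate, with the pick-up credit, at effective request rate `x`. -/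
def revenue (x : ℝ) : ℝ := x * (M.p0 + M.wpr * M.t0 + M.price x * M.t0)

/-- The largest revenue per rider. -/
def maxFare : ℝ := M.p0 + M.wpr * M.t0 + M.pMax * M.t0

/-- An upper bound on the revenue rate. -/
def maxRevenue : ℝ := M.maxFare * M.Lam

theorem zero_mem_Icc_Lam : (0 : ℝ) ∈ Icc 0 M.Lam := ⟨le_rfl, M.Lam_pos.le⟩

theorem Lam_mem_Icc_Lam : M.Lam ∈ Icc 0 M.Lam := ⟨M.Lam_pos.le, le_rfl⟩

theorem revenue_zero : M.revenue 0 = 0 := zero_mul _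

theorem continuousOn_revenue : ContinuousOn M.revenue (Icc 0 M.Lam) :=
  continuousOn_id.mul (continuousOn_const.add (M.continuousOn_price.mul continuousOn_const))

theorem fare_nonneg {p : ℝ} (hp : 0 ≤ p) : 0 ≤ M.p0 + M.wpr * M.t0 + p * M.t0 :=
  add_nonneg (add_nonneg M.p0_nonneg (mul_pos M.wpr_pos M.t0_pos).le) (mul_nonneg hp M.t0_pos.le)

theorem maxFare_nonneg : 0 ≤ M.maxFare :=
  have h := M.price_mem M.zero_mem_Icc_Lam
  M.fare_nonneg (h.1.trans h.2)

theorem revenue_nonneg {x : ℝ} (hx : x ∈ Icc 0 M.Lam) : 0 ≤ M.revenue x :=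
  mul_nonneg hx.1 (M.fare_nonneg (M.price_mem hx).1)

theorem revenue_le_maxFare_mul {x : ℝ} (hx : x ∈ Icc 0 M.Lam) :
    M.revenue x ≤ M.maxFare * x := by
  have := mul_le_mul_of_nonneg_right (M.price_mem hx).2 M.t0_pos.le
  rw [revenue, maxFare, mul_comm]
  exact mul_le_mul_of_nonneg_right (by linarith) hx.1

theorem maxRevenue_nonneg : 0 ≤ M.maxRevenue := mul_nonneg M.maxFare_nonneg M.Lam_pos.le

theorem revenue_le_maxRevenue {x : ℝ} (hx : x ∈ Icc 0 M.Lam) : M.revenue x ≤ M.maxRevenue :=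
  (M.revenue_le_maxFare_mul hx).trans (mul_le_mul_of_nonneg_left hx.2 M.maxFare_nonneg)

theorem exists_isMaxOn_revenue_add_mul (d : ℝ) :
    ∃ x ∈ Icc 0 M.Lam, IsMaxOn (fun x => M.revenue x + x * d) (Icc 0 M.Lam) x :=
  isCompact_Icc.exists_isMaxOn ⟨0, M.zero_mem_Icc_Lam⟩ (M.continuousOn_revenue.add (by fun_prop))

/-- A request rate that is optimal when an arrival changes the value of the state by `d`. -/
def optRate (d : ℝ) : ℝ := (M.exists_isMaxOn_revenue_add_mul d).choose

/-- The best rate of revenue plus change of value, when an arrival changes the value by `d`: the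
convex conjugate of minus the revenue. -/
def pricingGain (d : ℝ) : ℝ := M.revenue (M.optRate d) + M.optRate d * d

theorem optRate_mem (d : ℝ) : M.optRate d ∈ Icc 0 M.Lam :=
  (M.exists_isMaxOn_revenue_add_mul d).choose_spec.1

variable {M}

theorem le_pricingGain {x : ℝ} (hx : x ∈ Icc 0 M.Lam) (d : ℝ) :
    M.revenue x + x * d ≤ M.pricingGain d :=
  (M.exists_isMaxOn_revenue_add_mul d).choose_spec.2 hx

theorem pricingGain_le_add {d d' e : ℝ} (he : 0 ≤ e) (h : d ≤ d' + e) :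
    M.pricingGain d ≤ M.pricingGain d' + M.Lam * e := by
  have hx := M.optRate_mem d
  calc M.pricingGain d ≤ (M.revenue (M.optRate d) + M.optRate d * d') + M.optRate d * e := by
        have := mul_le_mul_of_nonneg_left h hx.1
        unfold pricingGain
        linarith
    _ ≤ M.pricingGain d' + M.Lam * e :=
        add_le_add (le_pricingGain hx d') (mul_le_mul_of_nonneg_right hx.2 he)

theorem continuous_pricingGain : Continuous M.pricingGain :=
  (LipschitzWith.of_le_add_mul ⟨M.Lam, M.Lam_pos.le⟩ fun d d' =>
    pricingGain_le_add dist_nonneg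
      (by linarith [Real.dist_eq d d', le_abs_self (d - d')])).continuous

theorem pricingGain_nonneg (d : ℝ) : 0 ≤ M.pricingGain d := by
  simpa [revenue_zero] using le_pricingGain M.zero_mem_Icc_Lam d

theorem Lam_mul_le_pricingGain (d : ℝ) : M.Lam * d ≤ M.pricingGain d :=
  (le_add_of_nonneg_left (M.revenue_nonneg M.Lam_mem_Icc_Lam)).trans
    (le_pricingGain M.Lam_mem_Icc_Lam d)

theorem pricingGain_le {d e : ℝ} (he : 0 ≤ e) (h : d ≤ e) :
    M.pricingGain d ≤ M.maxRevenue + M.Lam * e := by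
  have hzero : M.pricingGain 0 ≤ M.maxRevenue := by
    simpa [pricingGain] using M.revenue_le_maxRevenue (M.optRate_mem 0)
  linarith [pricingGain_le_add (M := M) he (h.trans_eq (zero_add e).symm)]

variable (M) in
/-- The best rate of revenue plus value over the arrival ticks of the clock, when the value is `a`
after an arrival and `b` after a blocked one. -/
def arrivalValue (a b : ℝ) : ℝ := M.pricingGain (a - b) + M.Lam * b

theorem arrivalValue_mono {a a' b b' : ℝ} (ha : a ≤ a') (hb : b ≤ b') :
    M.arrivalValue a b ≤ M.arrivalValue a' b' := by
  have := pricingGain_le_add (M := M) (d := a - b) (d' := a' - b') (sub_nonneg.2 hb) (by linarith)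
  unfold arrivalValue
  linarith

theorem arrivalValue_le {a b c : ℝ} (ha : a ≤ c) (hb : b ≤ c) :
    M.arrivalValue a b ≤ M.maxRevenue + M.Lam * c := by
  have := pricingGain_le (M := M) (sub_nonneg.2 hb) (sub_le_sub_right ha b)
  unfold arrivalValue
  linarith

end Pricing

/-- The rate at which the drivers in service and the riders in the queue cost. -/
def penalty (l m : ℕ) : ℝ := M.cd * l + M.cr * m

end Model

namespace Policy

variable {M : Model} (P : Policy M)

/-! ### Verification of average rewards -/

section AverageReward

theorem reward_eq (x : ℕ × ℕ) :
    P.reward x = M.revenue (P.rate x.1 x.2) - M.penalty x.1 x.2 := by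
  simp only [reward, Model.revenue, Model.penalty]
  ring

theorem exists_abs_reward_le_mul_load :
    ∃ A, 0 ≤ A ∧ ∀ x : ℕ × ℕ, x.1 ≤ M.L → |P.reward x| ≤ A * load x := by
  have hR := M.maxRevenue_nonneg
  refine ⟨M.maxRevenue + |M.cd| + |M.cr|, by positivity, fun x hl => ?_⟩
  have hx := P.rate_mem x.1 x.2 hl
  have hrevenue : |M.revenue (P.rate x.1 x.2)| ≤ M.maxRevenue := by
    rw [abs_of_nonneg (M.revenue_nonneg hx)]
    exact M.revenue_le_maxRevenue hx
  calc |P.reward x| ≤ M.maxRevenue + (|M.cd| * x.1 + |M.cr| * x.2) := by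
        rw [reward_eq, Model.penalty]
        refine (abs_sub _ _).trans (add_le_add hrevenue ((abs_add_le _ _).trans_eq ?_))
        rw [abs_mul, abs_mul, Nat.abs_cast, Nat.abs_cast]
    _ ≤ M.maxRevenue + (|M.cd| * x.1 + |M.cr| * x.2)
        + ((|M.cd| + M.maxRevenue) * x.2 + (|M.cr| + M.maxRevenue) * x.1 + |M.cd| + |M.cr|) :=
        le_add_of_nonneg_right (by positivity)
    _ = (M.maxRevenue + |M.cd| + |M.cr|) * load x := by
        unfold load
        ring

theorem tendsto_coe_add_div_atTop (g C : ℝ) :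
    Tendsto (fun T : ℝ => ((g + C / T : ℝ) : EReal)) atTop (𝓝 (g : EReal)) := by
  rw [EReal.tendsto_coe]
  simpa using tendsto_const_nhds.add (tendsto_id.const_div_atTop C)

variable {P} {S : Set (ℕ × ℕ)} {u : ℕ × ℕ → ℝ}

theorem limsup_avgReward_le (hS : P.IsInvariant S) {g B : ℝ}
    (h : ∀ x ∈ S, P.reward x + M.clock * (P.step u x - u x) ≤ g) (hB : ∀ x ∈ S, B ≤ u x) {l m : ℕ}
    (hx : settle P.dispatch l m ∈ S) :
    limsup (fun T => ((P.avgReward T l m : ℝ) : EReal)) atTop ≤ (g : EReal) := by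
  obtain ⟨A, hA, hreward⟩ := P.exists_abs_reward_le_mul_load
  rw [← (tendsto_coe_add_div_atTop g (u (settle P.dispatch l m) - B)).limsup_eq]
  refine limsup_le_limsup ?_
  filter_upwards [eventually_gt_atTop 0] with T hT
  have := integral_expect_le hS hA (fun x hx => hreward x (hS.le_L hx)) h hB hx hT.le
  rw [EReal.coe_le_coe_iff, avgReward, div_le_iff₀ hT, add_mul, div_mul_cancel₀ _ hT.ne']
  exact this

theorem le_avgReward (hS : P.IsInvariant S) {g B : ℝ}
    (h : ∀ x ∈ S, g ≤ P.reward x + M.clock * (P.step u x - u x)) (hB : ∀ x ∈ S, u x ≤ B) {l m : ℕ}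
    (hx : settle P.dispatch l m ∈ S) {T : ℝ} (hT : 0 < T) :
    g + (u (settle P.dispatch l m) - B) / T ≤ P.avgReward T l m := by
  obtain ⟨A, hA, hreward⟩ := P.exists_abs_reward_le_mul_load
  have := le_integral_expect hS hA (fun x hx => hreward x (hS.le_L hx)) h hB hx hT.le
  rwa [avgReward, le_div_iff₀ hT, add_mul, div_mul_cancel₀ _ hT.ne']

theorem isOptimal_of_le_avgReward {g : ℕ → ℕ → ℝ}
    (hle : ∀ (Q : Policy M) (l m : ℕ), l ≤ M.L →
      limsup (fun T => ((Q.avgReward T l m : ℝ) : EReal)) atTop ≤ (g l m : EReal))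
    (hge : ∀ l m, l ≤ M.L → ∃ C, ∀ T, 0 < T → g l m + C / T ≤ P.avgReward T l m) :
    P.IsOptimal := by
  refine ⟨g, fun l m hl => ⟨?_, fun Q => hle Q l m hl⟩⟩
  obtain ⟨C, hC⟩ := hge l m hl
  rw [← EReal.tendsto_coe]
  refine tendsto_of_le_liminf_of_limsup_le ?_ (hle P l m hl)
  rw [← (tendsto_coe_add_div_atTop (g l m) C).liminf_eq]
  refine liminf_le_liminf ?_
  filter_upwards [eventually_gt_atTop 0] with T hT
  exact EReal.coe_le_coe_iff.2 (hC T hT)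

end AverageReward

/-! ### A platform without drivers -/

section NoDrivers

theorem settle_of_L_eq_zero (hL : M.L = 0) (m : ℕ) : settle P.dispatch 0 m = (0, m) := by
  have := P.dispatch_no_driver m
  rw [hL] at this
  cases m with
  | zero => rfl
  | succ m => simp [settle, this]

theorem isInvariant_of_L_eq_zero (hL : M.L = 0) (m : ℕ) :
    P.IsInvariant {x | x.1 = 0 ∧ m ≤ x.2} where
  le_L hx := hx.1.trans_le (Nat.zero_le _)
  arrival := by
    rintro ⟨_, n⟩ ⟨rfl, hn⟩ -
    rw [settle_of_L_eq_zero P hL]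
    exact ⟨rfl, hn.trans n.le_succ⟩
  completion := by
    rintro ⟨_, n⟩ ⟨rfl, _⟩ h
    exact absurd (M.totalRate_zero_left n) h

/-- Riders admitted to a queue that is never served cost `c_r` each for ever, which no fare makes up
for: once `N ≥ maxRevenue / c_r` riders have joined, the revenue rate is below their penalty. The
fares of the riders that join before are accounted for by the potential. -/
theorem limsup_avgReward_le_of_L_eq_zero (hL : M.L = 0) (m : ℕ) :
    limsup (fun T => ((P.avgReward T 0 m : ℝ) : EReal)) atTop ≤ ((-(M.cr * m) : ℝ) : EReal) := by
  have hcr : 0 < M.cr := M.wqr_pos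
  have hfare := M.maxFare_nonneg
  obtain ⟨N, hN⟩ := exists_nat_ge (M.maxRevenue / M.cr)
  rw [div_le_iff₀ hcr] at hN
  have hmem : settle P.dispatch 0 m ∈ {x : ℕ × ℕ | x.1 = 0 ∧ m ≤ x.2} := by
    simp [settle_of_L_eq_zero P hL]
  refine limsup_avgReward_le (P.isInvariant_of_L_eq_zero hL m)
    (u := fun x => -(M.maxFare * min (x.2 : ℝ) (m + N))) (B := -(M.maxFare * (m + N)))
    ?_
    (fun x _ => neg_le_neg (mul_le_mul_of_nonneg_left (min_le_right _ _) hfare)) hmem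
  rintro ⟨_, n⟩ ⟨rfl, hn⟩
  have hn' : (m : ℝ) ≤ n := by exact_mod_cast hn
  have hrate := P.rate_mem 0 n (Nat.zero_le _)
  rw [clock_mul_step_sub, reward_eq, settle_of_L_eq_zero P hL, M.totalRate_zero_left, zero_mul,
    add_zero, Model.penalty]
  push_cast
  rcases lt_or_ge n (m + N) with h | h
  · have h' : (n : ℝ) + 1 ≤ m + N := by exact_mod_cast h
    rw [min_eq_left h', min_eq_left (by linarith)]
    nlinarith [M.revenue_le_maxFare_mul hrate]
  · have h' : (m : ℝ) + N ≤ n := by exact_mod_cast h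
    rw [min_eq_right h', min_eq_right (by linarith)]
    nlinarith [M.revenue_le_maxRevenue hrate]

variable (M) in
/-- The policy that turns every rider away and never dispatches. -/
def idle : Policy M where
  rate _ _ := 0
  rate_mem _ _ _ := M.zero_mem_Icc_Lam
  dispatch _ _ := 0
  dispatch_no_rider _ := rfl
  dispatch_no_driver _ := rfl

theorem isOptimal_idle (hL : M.L = 0) : (idle M).IsOptimal := by
  refine isOptimal_of_le_avgReward (g := fun _ m => -(M.cr * m)) (fun Q l m hl => ?_)
    fun l m hl => ⟨0, fun T hT => ?_⟩
  · obtain rfl : l = 0 := by omega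
    exact Q.limsup_avgReward_le_of_L_eq_zero hL m
  obtain rfl : l = 0 := by omega
  have hS : (idle M).IsInvariant {(0, m)} :=
    { le_L := by simp
      arrival := fun _ h => absurd rfl h
      completion := by simp [M.totalRate_zero_left] }
  have := le_avgReward hS (g := -(M.cr * m)) (u := fun _ => 0) (B := 0) (l := 0) (m := m)
    (by simp [step_const, reward_eq, Model.penalty, idle, M.revenue_zero]) (by simp)
    (by simp [settle_of_L_eq_zero _ hL]) hT
  simpa using this

end NoDrivers

end Policy

namespace Model

variable {M : Model}

/-! ### The discounted problem with truncated costs -/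

section Cost

theorem penalty_zero_zero : M.penalty 0 0 = 0 := by simp [penalty]

theorem penalty_nonneg (hcd : 0 ≤ M.cd) (l m : ℕ) : 0 ≤ M.penalty l m :=
  add_nonneg (mul_nonneg hcd l.cast_nonneg) (mul_nonneg M.wqr_pos.le m.cast_nonneg)

theorem penalty_succ_left_le_succ_right (h : M.cd ≤ M.cr) (l m : ℕ) :
    M.penalty (l + 1) m ≤ M.penalty l (m + 1) := by
  simp only [penalty]
  push_cast
  linarith

theorem penalty_succ_right_le_succ_left (h : M.cr ≤ M.cd) (l m : ℕ) :
    M.penalty l (m + 1) ≤ M.penalty (l + 1) m := by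
  simp only [penalty]
  push_cast
  linarith

theorem penalty_le_succ_left (hcd : 0 ≤ M.cd) (l m : ℕ) :
    M.penalty l m ≤ M.penalty (l + 1) m := by
  simp only [penalty]
  push_cast
  linarith

variable (M) in
/-- The penalty rate truncated at `K`. The truncation makes the values of the discounted problem
bounded, so that they are limits of value iteration. -/
def cost (K : ℝ) (l m : ℕ) : ℝ := min (M.penalty l m) K

theorem cost_le_penalty (K : ℝ) (l m : ℕ) : M.cost K l m ≤ M.penalty l m := min_le_left _ _

theorem cost_nonneg (hcd : 0 ≤ M.cd) {K : ℝ} (hK : 0 ≤ K) (l m : ℕ) : 0 ≤ M.cost K l m :=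
  le_min (penalty_nonneg hcd l m) hK

end Cost

section ServiceValue

variable (M) in
/-- The value, over the completion ticks of the clock, of the state they lead to from `(l, m)`. -/
def serviceValue (V : ℕ → ℕ → ℝ) (l m : ℕ) : ℝ :=
  M.totalRate l m * V (l - 1) m + (M.maxTotalRate - M.totalRate l m) * V l m

variable {V V' : ℕ → ℕ → ℝ} {l : ℕ} {m : ℕ}

theorem serviceValue_mono (h : ∀ l ≤ M.L, ∀ m, V l m ≤ V' l m) (hl : l ≤ M.L) (m : ℕ) :
    M.serviceValue V l m ≤ M.serviceValue V' l m :=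
  add_le_add
    (mul_le_mul_of_nonneg_left (h _ ((Nat.sub_le l 1).trans hl) m) (totalRate_nonneg hl m))
    (mul_le_mul_of_nonneg_left (h l hl m) (sub_nonneg.2 (totalRate_le hl m)))

theorem serviceValue_le {c : ℝ} (hl : l ≤ M.L) (h : V (l - 1) m ≤ c) (h' : V l m ≤ c) :
    M.serviceValue V l m ≤ M.maxTotalRate * c := by
  have h₁ := mul_le_mul_of_nonneg_left h (totalRate_nonneg hl m)
  have h₂ := mul_le_mul_of_nonneg_left h' (sub_nonneg.2 (totalRate_le hl m))
  unfold serviceValue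
  linarith

theorem le_serviceValue {c : ℝ} (hl : l ≤ M.L) (h : c ≤ V (l - 1) m) (h' : c ≤ V l m) :
    M.maxTotalRate * c ≤ M.serviceValue V l m := by
  have h₁ := mul_le_mul_of_nonneg_left h (totalRate_nonneg hl m)
  have h₂ := mul_le_mul_of_nonneg_left h' (sub_nonneg.2 (totalRate_le hl m))
  unfold serviceValue
  linarith

/-- Couple the completions at the two states: all those at `(l, m)` also occur at `(l', m')`. -/
theorem serviceValue_le_of_totalRate_le {l' m' : ℕ} (hl : l ≤ M.L) (hl' : l' ≤ M.L)
    (hrate : M.totalRate l m ≤ M.totalRate l' m') (hboth : V (l - 1) m ≤ V (l' - 1) m')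
    (hone : V l m ≤ V (l' - 1) m') (hnone : V l m ≤ V l' m') :
    M.serviceValue V l m ≤ M.serviceValue V l' m' := by
  have h₁ := mul_le_mul_of_nonneg_left hboth (totalRate_nonneg hl m)
  have h₂ := mul_le_mul_of_nonneg_left hone (sub_nonneg.2 hrate)
  have h₃ := mul_le_mul_of_nonneg_left hnone (sub_nonneg.2 (totalRate_le hl' m'))
  unfold serviceValue
  linarith

end ServiceValue

section Bellman

variable (M) in
/-- The discounted value, at discount rate `β`, of holding at `(l, m)` until the next tick of the
clock, when the continuation value is `V`. -/
def hold (β K : ℝ) (V : ℕ → ℕ → ℝ) (l m : ℕ) : ℝ :=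
  (M.arrivalValue (V l (m + 1)) (V l m) + M.serviceValue V l m - M.cost K l m) / (β + M.clock)

variable (M) in
/-- The Bellman operator of the discounted problem: hold until the next tick of the clock, or
dispatch if possible. -/
def bellman (β K : ℝ) (V : ℕ → ℕ → ℝ) (l m : ℕ) : ℝ :=
  if l < M.L ∧ 0 < m then max (M.hold β K V l m) (V (l + 1) (m - 1)) else M.hold β K V l m

variable (M) in
/-- The best drift of `V` under holding: the rate of revenue plus change of value. -/
def drift (V : ℕ → ℕ → ℝ) (l m : ℕ) : ℝ :=
  M.pricingGain (V l (m + 1) - V l m) + M.totalRate l m * (V (l - 1) m - V l m)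

variable {β K : ℝ} {V V' : ℕ → ℕ → ℝ} {l m : ℕ}

theorem discount_add_clock_pos (hβ : 0 < β) : 0 < β + M.clock := add_pos hβ M.clock_pos

theorem drift_add_clock_mul (V : ℕ → ℕ → ℝ) (l m : ℕ) :
    M.drift V l m + M.clock * V l m
      = M.arrivalValue (V l (m + 1)) (V l m) + M.serviceValue V l m := by
  simp only [drift, arrivalValue, serviceValue, clock_eq]
  ring

theorem hold_le_iff (hβ : 0 < β) :
    M.hold β K V l m ≤ V l m ↔ M.drift V l m ≤ M.cost K l m + β * V l m := by
  rw [hold, ← drift_add_clock_mul, div_le_iff₀ (discount_add_clock_pos hβ)]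
  constructor <;> intro h <;> linarith

theorem le_hold_iff (hβ : 0 < β) :
    V l m ≤ M.hold β K V l m ↔ M.cost K l m + β * V l m ≤ M.drift V l m := by
  rw [hold, ← drift_add_clock_mul, le_div_iff₀ (discount_add_clock_pos hβ)]
  constructor <;> intro h <;> linarith

theorem hold_eq_iff (hβ : 0 < β) :
    M.hold β K V l m = V l m ↔ M.drift V l m = M.cost K l m + β * V l m := by
  rw [le_antisymm_iff, hold_le_iff hβ, le_hold_iff hβ, ← le_antisymm_iff]

theorem hold_le_hold (hβ : 0 < β) {l' m' : ℕ} (harr : V l (m + 1) ≤ V' l' (m' + 1))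
    (h : V l m ≤ V' l' m') (hserv : M.serviceValue V l m ≤ M.serviceValue V' l' m')
    (hcost : M.cost K l' m' ≤ M.cost K l m) : M.hold β K V l m ≤ M.hold β K V' l' m' :=
  div_le_div_of_nonneg_right (sub_le_sub (add_le_add (arrivalValue_mono harr h) hserv) hcost)
    (discount_add_clock_pos hβ).le

theorem hold_mono (hβ : 0 < β) (h : ∀ l ≤ M.L, ∀ m, V l m ≤ V' l m) (hl : l ≤ M.L) (m : ℕ) :
    M.hold β K V l m ≤ M.hold β K V' l m :=
  hold_le_hold hβ (h l hl _) (h l hl m) (serviceValue_mono h hl m) le_rfl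

theorem hold_le_of_forall_le (hβ : 0 < β) {D : ℝ} (hV : ∀ l ≤ M.L, ∀ m, V l m ≤ D) (hl : l ≤ M.L)
    (hD : M.maxRevenue ≤ M.cost K l m + β * D) : M.hold β K V l m ≤ D := by
  have harr := arrivalValue_le (M := M) (hV l hl (m + 1)) (hV l hl m)
  have hserv := serviceValue_le hl (hV (l - 1) ((Nat.sub_le l 1).trans hl) m) (hV l hl m)
  rw [hold, div_le_iff₀ (discount_add_clock_pos hβ), clock_eq]
  linarith

theorem hold_succ_left_le (hβ : 0 < β) (hcd : 0 ≤ M.cd) (hV : ∀ l < M.L, ∀ m, V (l + 1) m ≤ V l m)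
    (hl : l < M.L) (m : ℕ) : M.hold β K V (l + 1) m ≤ M.hold β K V l m := by
  have hpred : V l m ≤ V (l - 1) m := by
    cases l with
    | zero => rfl
    | succ l => exact hV l (l.lt_succ_self.trans hl) m
  exact hold_le_hold hβ (hV l hl _) (hV l hl m)
    ((serviceValue_le hl le_rfl (hV l hl m)).trans (le_serviceValue hl.le hpred le_rfl))
    (min_le_min_right K (penalty_le_succ_left hcd l m))

theorem hold_le_hold_dispatch (hM : M.ZigzagType2) (hcr : M.cd ≤ M.cr) (hβ : 0 < β)
    (hV : ∀ l < M.L, ∀ m, V (l + 1) m ≤ V l m)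
    (hV₂ : ∀ l m, M.IsType2 l (m + 1) → V l (m + 1) ≤ V (l + 1) m) (h : M.IsType2 l (m + 1)) :
    M.hold β K V l (m + 1) ≤ M.hold β K V (l + 1) m := by
  have hone : V l (m + 1) ≤ V l m := (hV₂ l m h).trans (hV l h.lt m)
  have hboth : V (l - 1) (m + 1) ≤ V l m := by
    cases l with
    | zero => exact hone
    | succ l => exact hV₂ l m (hM.of_succ_left h)
  exact hold_le_hold hβ (hV₂ l (m + 1) (hM.succ_right h)) (hV₂ l m h)
    (serviceValue_le_of_totalRate_le h.lt.le h.lt (isType2_succ_iff.1 h).2 hboth hone (hV₂ l m h))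
    (min_le_min_right K (penalty_succ_left_le_succ_right hcr l m))

theorem hold_dispatch_le_hold (hcr : M.cr ≤ M.cd) (hβ : 0 < β)
    (hV : ∀ l < M.L, ∀ m, V (l + 1) m ≤ V l m) (hV₁ : ∀ l < M.L, ∀ m, V (l + 1) m ≤ V l (m + 1))
    (hl : l < M.L) (h : M.totalRate (l + 1) m < M.totalRate l (m + 1)) :
    M.hold β K V (l + 1) m ≤ M.hold β K V l (m + 1) := by
  cases l with
  | zero => exact absurd (totalRate_nonneg hl m) (by simpa [totalRate_zero_left] using h)
  | succ l =>
    have hboth : V (l + 1) m ≤ V l (m + 1) := hV₁ l (l.lt_succ_self.trans hl) m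
    exact hold_le_hold hβ (hV₁ _ hl (m + 1)) (hV₁ _ hl m)
      (serviceValue_le_of_totalRate_le hl hl.le h.le hboth ((hV _ hl m).trans hboth) (hV₁ _ hl m))
      (min_le_min_right K (penalty_succ_right_le_succ_left hcr (l + 1) m))

theorem hold_le_bellman (V : ℕ → ℕ → ℝ) (l m : ℕ) : M.hold β K V l m ≤ M.bellman β K V l m := by
  unfold bellman
  split_ifs
  · exact le_max_left _ _
  · rfl

theorem bellman_succ_right (hl : l < M.L) (m : ℕ) :
    M.bellman β K V l (m + 1) = max (M.hold β K V l (m + 1)) (V (l + 1) m) :=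
  if_pos ⟨hl, m.succ_pos⟩

theorem bellman_mono (hβ : 0 < β) (h : ∀ l ≤ M.L, ∀ m, V l m ≤ V' l m) (hl : l ≤ M.L) (m : ℕ) :
    M.bellman β K V l m ≤ M.bellman β K V' l m := by
  unfold bellman
  split_ifs with hlm
  · exact max_le_max (hold_mono hβ h hl m) (h _ hlm.1 _)
  · exact hold_mono hβ h hl m

theorem bellman_le_of_forall_le (hβ : 0 < β) {D : ℝ} (hV : ∀ l ≤ M.L, ∀ m, V l m ≤ D)
    (hl : l ≤ M.L) (hD : M.maxRevenue ≤ M.cost K l m + β * D) : M.bellman β K V l m ≤ D := by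
  have h := hold_le_of_forall_le hβ hV hl hD
  unfold bellman
  split_ifs with hlm
  · exact max_le h (hV _ hlm.1 _)
  · exact h

theorem bellman_succ_left_le (hβ : 0 < β) (hcd : 0 ≤ M.cd)
    (hV : ∀ l < M.L, ∀ m, V (l + 1) m ≤ V l m) (hl : l < M.L) (m : ℕ) :
    M.bellman β K V (l + 1) m ≤ M.bellman β K V l m := by
  have h := hold_succ_left_le (K := K) hβ hcd hV hl m
  unfold bellman
  split_ifs with h₁ h₂
  · exact max_le_max h (hV _ h₁.1 _)
  · exact absurd ⟨hl, h₁.2⟩ h₂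
  · exact h.trans (le_max_left _ _)
  · exact h

theorem tendsto_drift {ι : Type*} {F : Filter ι} {U : ι → ℕ → ℕ → ℝ}
    (h : ∀ l ≤ M.L, ∀ m, Tendsto (fun i => U i l m) F (𝓝 (V l m))) (hl : l ≤ M.L) (m : ℕ) :
    Tendsto (fun i => M.drift (U i) l m) F (𝓝 (M.drift V l m)) :=
  ((continuous_pricingGain.tendsto _).comp ((h l hl (m + 1)).sub (h l hl m))).add
    (((h (l - 1) ((Nat.sub_le l 1).trans hl) m).sub (h l hl m)).const_mul _)

theorem tendsto_bellman {ι : Type*} {F : Filter ι} {U : ι → ℕ → ℕ → ℝ}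
    (h : ∀ l ≤ M.L, ∀ m, Tendsto (fun i => U i l m) F (𝓝 (V l m))) (hl : l ≤ M.L) (m : ℕ) :
    Tendsto (fun i => M.bellman β K (U i) l m) F (𝓝 (M.bellman β K V l m)) := by
  have hhold : Tendsto (fun i => M.hold β K (U i) l m) F (𝓝 (M.hold β K V l m)) := by
    simp only [hold, ← drift_add_clock_mul]
    exact (((tendsto_drift h hl m).add ((h l hl m).const_mul _)).sub_const _).div_const _
  unfold bellman
  split_ifs with hlm
  · exact hhold.max (h _ hlm.1 _)
  · exact hhold

end Bellman

section ValueIteration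

variable (M) in
/-- Value iteration, started from the least possible value. -/
def iter (β K : ℝ) (n : ℕ) : ℕ → ℕ → ℝ := (M.bellman β K)^[n] fun _ _ => -(K / β)

variable {β K : ℝ}

theorem iter_zero (l m : ℕ) : M.iter β K 0 l m = -(K / β) := rfl

theorem iter_succ (n : ℕ) : M.iter β K (n + 1) = M.bellman β K (M.iter β K n) :=
  Function.iterate_succ_apply' _ _ _

theorem iter_le_succ (hβ : 0 < β) (n : ℕ) :
    ∀ l ≤ M.L, ∀ m, M.iter β K n l m ≤ M.iter β K (n + 1) l m := by
  induction n with
  | zero =>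
    intro l _ m
    rw [iter_succ]
    refine le_trans ((le_hold_iff hβ).2 ?_) (hold_le_bellman _ _ _)
    have hcost : M.cost K l m ≤ K := min_le_right _ _
    have hdrift : 0 ≤ M.drift (M.iter β K 0) l m := by
      simpa [drift, iter_zero] using pricingGain_nonneg (M := M) 0
    rw [iter_zero, mul_neg, mul_div_cancel₀ K hβ.ne']
    linarith
  | succ n ih =>
    intro l hl m
    rw [iter_succ, iter_succ (n + 1)]
    exact bellman_mono hβ ih hl m

theorem iter_le_of_le_or_maxRevenue_le (hβ : 0 < β) {D : ℝ} (hD : -(K / β) ≤ D)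
    (h : ∀ n, ∀ l ≤ M.L, ∀ m, M.iter β K n l m ≤ D ∨ M.maxRevenue ≤ M.cost K l m + β * D) (n : ℕ) :
    ∀ l ≤ M.L, ∀ m, M.iter β K n l m ≤ D := by
  induction n with
  | zero => exact fun _ _ _ => hD
  | succ n ih =>
    intro l hl m
    refine (h (n + 1) l hl m).elim id fun hlm => ?_
    rw [iter_succ]
    exact bellman_le_of_forall_le hβ ih hl hlm

theorem iter_le_maxRevenue_div (hβ : 0 < β) (hcd : 0 ≤ M.cd) (hK : 0 ≤ K) (n : ℕ) :
    ∀ l ≤ M.L, ∀ m, M.iter β K n l m ≤ M.maxRevenue / β := by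
  have hR := M.maxRevenue_nonneg
  refine iter_le_of_le_or_maxRevenue_le hβ ?_ (fun _ l _ m => Or.inr ?_) n
  · exact (neg_nonpos.2 (by positivity)).trans (by positivity)
  · rw [mul_div_cancel₀ _ hβ.ne']
    exact le_add_of_nonneg_left (cost_nonneg hcd hK l m)

theorem iter_succ_left_le (hβ : 0 < β) (hcd : 0 ≤ M.cd) (n : ℕ) :
    ∀ l < M.L, ∀ m, M.iter β K n (l + 1) m ≤ M.iter β K n l m := by
  induction n with
  | zero => exact fun _ _ _ => le_rfl
  | succ n ih =>
    rw [iter_succ]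
    exact fun l hl m => bellman_succ_left_le hβ hcd ih hl m

theorem iter_le_iter_dispatch (hM : M.ZigzagType2) (hcr : M.cd ≤ M.cr) (hβ : 0 < β)
    (hcd : 0 ≤ M.cd) (n : ℕ) :
    ∀ l m, M.IsType2 l (m + 1) → M.iter β K n l (m + 1) ≤ M.iter β K n (l + 1) m := by
  induction n with
  | zero => exact fun _ _ _ => le_rfl
  | succ n ih =>
    intro l m h
    have hhold : M.hold β K (M.iter β K n) l (m + 1) ≤ M.iter β K (n + 1) (l + 1) m := by
      rw [iter_succ]
      exact (hold_le_hold_dispatch hM hcr hβ (iter_succ_left_le hβ hcd n) ih h).trans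
        (hold_le_bellman _ _ _)
    rw [iter_succ, bellman_succ_right h.lt, ← iter_succ]
    exact max_le hhold (iter_le_succ hβ n _ h.lt m)

end ValueIteration

section Value

variable (M) in
/-- The optimal value of the discounted problem with truncated costs. -/
def value (β K : ℝ) (l m : ℕ) : ℝ := ⨆ n, M.iter β K n l m

variable {β K : ℝ} (hβ : 0 < β) (hcd : 0 ≤ M.cd) (hK : 0 ≤ K) {l : ℕ}

include hβ hcd hK

theorem bddAbove_range_iter (hl : l ≤ M.L) (m : ℕ) :
    BddAbove (range fun n => M.iter β K n l m) :=
  ⟨_, forall_mem_range.2 fun n => iter_le_maxRevenue_div hβ hcd hK n l hl m⟩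

theorem iter_le_value (hl : l ≤ M.L) (m n : ℕ) : M.iter β K n l m ≤ M.value β K l m :=
  le_ciSup (bddAbove_range_iter hβ hcd hK hl m) n

theorem tendsto_iter : ∀ l ≤ M.L, ∀ m,
    Tendsto (fun n => M.iter β K n l m) atTop (𝓝 (M.value β K l m)) :=
  fun l hl m => tendsto_atTop_ciSup (monotone_nat_of_le_succ fun n => iter_le_succ hβ n l hl m)
    (bddAbove_range_iter hβ hcd hK hl m)

theorem bellman_value (hl : l ≤ M.L) (m : ℕ) :
    M.bellman β K (M.value β K) l m = M.value β K l m := by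
  have h := tendsto_iter hβ hcd hK
  refine tendsto_nhds_unique (tendsto_bellman h hl m) ?_
  simpa only [iter_succ] using (tendsto_add_atTop_iff_nat 1).2 (h l hl m)

theorem le_value (hl : l ≤ M.L) (m : ℕ) : -(K / β) ≤ M.value β K l m :=
  iter_le_value hβ hcd hK hl m 0

theorem value_le (hl : l ≤ M.L) (m : ℕ) : M.value β K l m ≤ M.maxRevenue / β :=
  ciSup_le fun n => iter_le_maxRevenue_div hβ hcd hK n l hl m

theorem mul_value_le (hl : l ≤ M.L) (m : ℕ) : β * M.value β K l m ≤ M.maxRevenue := by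
  rw [mul_comm, ← le_div_iff₀ hβ]
  exact value_le hβ hcd hK hl m

theorem value_succ_left_le (hl : l < M.L) (m : ℕ) : M.value β K (l + 1) m ≤ M.value β K l m :=
  le_of_tendsto_of_tendsto' (tendsto_iter hβ hcd hK _ hl m) (tendsto_iter hβ hcd hK l hl.le m)
    fun n => iter_succ_left_le hβ hcd n l hl m

theorem value_dispatch_le (hl : l < M.L) (m : ℕ) :
    M.value β K (l + 1) m ≤ M.value β K l (m + 1) := by
  rw [← bellman_value hβ hcd hK hl.le (m + 1), bellman_succ_right hl]
  exact le_max_right _ _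

theorem value_dispatch_eq_of_isType2 (hM : M.ZigzagType2) (hcr : M.cd ≤ M.cr) {m : ℕ}
    (h : M.IsType2 l (m + 1)) : M.value β K (l + 1) m = M.value β K l (m + 1) :=
  (value_dispatch_le hβ hcd hK h.lt m).antisymm <|
    le_of_tendsto_of_tendsto' (tendsto_iter hβ hcd hK l h.lt.le _) (tendsto_iter hβ hcd hK _ h.lt m)
      fun n => iter_le_iter_dispatch hM hcr hβ hcd n l m h

theorem drift_value_le (hl : l ≤ M.L) (m : ℕ) :
    M.drift (M.value β K) l m ≤ M.cost K l m + β * M.value β K l m :=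
  (hold_le_iff hβ).1 ((hold_le_bellman _ _ _).trans_eq (bellman_value hβ hcd hK hl m))

theorem drift_value_eq_or (hl : l ≤ M.L) (m : ℕ) :
    M.drift (M.value β K) l m = M.cost K l m + β * M.value β K l m ∨
      (l < M.L ∧ 0 < m) ∧ M.value β K (l + 1) (m - 1) = M.value β K l m := by
  rw [← hold_eq_iff hβ]
  have h := bellman_value hβ hcd hK hl m
  unfold bellman at h
  split_ifs at h with hlm
  · rcases max_choice (M.hold β K (M.value β K) l m) (M.value β K (l + 1) (m - 1)) with h' | h'
    · exact Or.inl (h'.symm.trans h)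
    · exact Or.inr ⟨hlm, h'.symm.trans h⟩
  · exact Or.inl h

theorem drift_value_eq_of_isType1 (hM : M.ZigzagType2) (hcr : M.cr ≤ M.cd) {m : ℕ}
    (h : M.IsType1 l m) :
    M.drift (M.value β K) l m = M.cost K l m + β * M.value β K l m := by
  induction m generalizing l with
  | zero => exact (drift_value_eq_or hβ hcd hK h.1 0).resolve_right fun h' => h'.1.2.false
  | succ m ih =>
    refine (drift_value_eq_or hβ hcd hK h.1 (m + 1)).elim id fun ⟨⟨hl, _⟩, hV⟩ => ?_
    have hrate : M.totalRate (l + 1) m < M.totalRate l (m + 1) :=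
      (h.2.resolve_left hl.ne).resolve_left m.succ_ne_zero
    have hnext : M.IsType1 (l + 1) m := by
      by_contra h'
      exact (hM.succ_right (hM.of_succ_left ⟨hl, h'⟩)).2 h
    rw [← hold_eq_iff hβ]
    refine le_antisymm ((hold_le_iff hβ).2 (drift_value_le hβ hcd hK hl.le _)) ?_
    calc M.value β K l (m + 1) = M.value β K (l + 1) m := hV.symm
      _ = M.hold β K (M.value β K) (l + 1) m := ((hold_eq_iff hβ).2 (ih hnext)).symm
      _ ≤ M.hold β K (M.value β K) l (m + 1) :=
        hold_dispatch_le_hold hcr hβ (fun l hl m => value_succ_left_le hβ hcd hK hl m)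
          (fun l hl m => value_dispatch_le hβ hcd hK hl m) hl hrate

end Value

end Model

namespace Model

variable {M : Model}

/-! ### Bounds on the values that are uniform in the discount rate -/

section UniformBounds

variable (M) in
/-- A bound on the increase of the values from `(0, 0)` to `(0, m)`: by the cost of the request
rate `Λ` at each step. -/
def riseBound (m : ℕ) : ℝ := ∑ j ∈ Finset.range m, (M.maxRevenue + M.penalty 0 j) / M.Lam

variable (M) in
/-- A bound on the decrease of the values when one of `l` drivers in service at `(l, m)` becomes
free: by the cost of waiting for a completion. -/
def completionBound (l m : ℕ) : ℝ := (M.maxRevenue + M.penalty l m) / M.totalRate l m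

variable (M) in
/-- A bound on the decrease of the values from `(0, 0)` to `(l, m)`: the queue is emptied through
the states with one driver in service. -/
def fallBound (l m : ℕ) : ℝ :=
  ∑ j ∈ Finset.range m, M.completionBound 1 j
    + ∑ i ∈ Finset.range l, M.completionBound (i + 1) m

variable (M) in
/-- A queue length from which on the riders waiting cost more than the largest revenue rate. -/
def longQueue : ℕ := ⌈M.maxRevenue / M.cr⌉₊

theorem monotone_riseBound (hcd : 0 ≤ M.cd) : Monotone M.riseBound := by
  refine fun m n h => Finset.sum_le_sum_of_subset_of_nonneg (Finset.range_mono h) fun j _ _ => ?_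
  exact div_nonneg (add_nonneg M.maxRevenue_nonneg (penalty_nonneg hcd 0 j)) M.Lam_pos.le

theorem riseBound_nonneg (hcd : 0 ≤ M.cd) (m : ℕ) : 0 ≤ M.riseBound m := by
  simpa [riseBound] using monotone_riseBound hcd m.zero_le

theorem maxRevenue_le_penalty (hcd : 0 ≤ M.cd) {m : ℕ} (hm : M.longQueue ≤ m) (l : ℕ) :
    M.maxRevenue ≤ M.penalty l m := by
  have h := (div_le_iff₀ M.wqr_pos).1 (Nat.ceil_le.1 hm)
  have := mul_nonneg hcd (l.cast_nonneg (α := ℝ))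
  unfold penalty cr
  linarith

variable {β K : ℝ} (hβ : 0 < β) (hcd : 0 ≤ M.cd) (hK : 0 ≤ K) {l : ℕ}

include hβ hcd hK

theorem drift_value_le_maxRevenue_add_penalty (hl : l ≤ M.L) (m : ℕ) :
    M.drift (M.value β K) l m ≤ M.maxRevenue + M.penalty l m := by
  linarith [drift_value_le hβ hcd hK hl m, cost_le_penalty (M := M) K l m,
    mul_value_le hβ hcd hK hl m]

theorem value_zero_succ_le (m : ℕ) :
    M.value β K 0 (m + 1) ≤ M.value β K 0 m + (M.maxRevenue + M.penalty 0 m) / M.Lam := by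
  have h := drift_value_le_maxRevenue_add_penalty hβ hcd hK M.L.zero_le m
  rw [drift, totalRate_zero_left, zero_mul, add_zero] at h
  rw [← sub_le_iff_le_add', le_div_iff₀' M.Lam_pos]
  exact (Lam_mul_le_pricingGain _).trans h

theorem value_le_value_succ_left_add (hl : l < M.L) (m : ℕ) :
    M.value β K l m ≤ M.value β K (l + 1) m + M.completionBound (l + 1) m := by
  have h := drift_value_le_maxRevenue_add_penalty hβ hcd hK (Nat.succ_le_of_lt hl) m
  rw [← sub_le_iff_le_add', completionBound, le_div_iff₀' (totalRate_pos l.succ_ne_zero hl m)]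
  exact (le_add_of_nonneg_left (pricingGain_nonneg _)).trans h

theorem value_le_value_zero_left (hl : l ≤ M.L) (m : ℕ) : M.value β K l m ≤ M.value β K 0 m := by
  induction l with
  | zero => rfl
  | succ l ih => exact (value_succ_left_le hβ hcd hK hl m).trans (ih (Nat.le_of_lt hl))

theorem value_le_add_riseBound (hl : l ≤ M.L) (m : ℕ) :
    M.value β K l m ≤ M.value β K 0 0 + M.riseBound m := by
  refine (value_le_value_zero_left hβ hcd hK hl m).trans ?_
  clear hl
  induction m with
  | zero => simp [riseBound]
  | succ m ih =>
    rw [riseBound, Finset.sum_range_succ, ← riseBound]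
    linarith [value_zero_succ_le hβ hcd hK (M := M) m]

theorem value_zero_zero_le_add_fallBound (hL : 0 < M.L) (hl : l ≤ M.L) (m : ℕ) :
    M.value β K 0 0 ≤ M.value β K l m + M.fallBound l m := by
  induction l with
  | zero =>
    induction m with
    | zero => simp [fallBound]
    | succ m ih =>
      simp only [fallBound, Finset.sum_range_succ, Finset.sum_range_zero, add_zero] at ih ⊢
      linarith [value_dispatch_le hβ hcd hK hL m, value_le_value_succ_left_add hβ hcd hK hL m]
  | succ l ih =>
    have h := ih (Nat.le_of_lt hl)
    simp only [fallBound, Finset.sum_range_succ] at h ⊢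
    linarith [value_le_value_succ_left_add hβ hcd hK hl m]

theorem value_zero_zero_nonneg : 0 ≤ M.value β K 0 0 := by
  have h := drift_value_le hβ hcd hK M.L.zero_le 0
  rw [drift, totalRate_zero_left, zero_mul, add_zero, cost, penalty_zero_zero, min_eq_left hK] at h
  exact nonneg_of_mul_nonneg_right ((pricingGain_nonneg _).trans (h.trans_eq (zero_add _))) hβ

omit hK in
/-- At the states with a long queue, the bound comes from the Bellman equation itself: the costs
there exceed the revenue. -/
theorem value_le_add_riseBound_longQueue (hK : M.maxRevenue ≤ K) (hl : l ≤ M.L) (m : ℕ) :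
    M.value β K l m ≤ M.value β K 0 0 + M.riseBound M.longQueue := by
  have hK₀ : 0 ≤ K := M.maxRevenue_nonneg.trans hK
  have hD : 0 ≤ M.value β K 0 0 + M.riseBound M.longQueue :=
    add_nonneg (value_zero_zero_nonneg hβ hcd hK₀) (riseBound_nonneg hcd _)
  have hstart : -(K / β) ≤ 0 := neg_nonpos.2 (div_nonneg hK₀ hβ.le)
  refine ciSup_le fun n => iter_le_of_le_or_maxRevenue_le hβ (hstart.trans hD) ?_ n l hl m
  intro n l hl m
  rcases le_total m M.longQueue with h | h
  · left
    calc M.iter β K n l m ≤ M.value β K l m := iter_le_value hβ hcd hK₀ hl m n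
      _ ≤ M.value β K 0 0 + M.riseBound m := value_le_add_riseBound hβ hcd hK₀ hl m
      _ ≤ M.value β K 0 0 + M.riseBound M.longQueue :=
        add_le_add_right (monotone_riseBound hcd h) _
  · right
    exact (le_min (maxRevenue_le_penalty hcd h l) hK).trans
      (le_add_of_nonneg_right (mul_nonneg hβ.le hD))

end UniformBounds

end Model

namespace Policy

variable {M : Model} {P : Policy M}

section Drift

theorem reward_add_clock_mul_step_sub_le {u : ℕ → ℕ → ℝ}
    (hu : ∀ l m, l < M.L → P.dispatch l (m + 1) = 1 → u (l + 1) m ≤ u l (m + 1)) {x : ℕ × ℕ}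
    (hx : x.1 ≤ M.L) :
    P.reward x + M.clock * (P.step (fun y => u y.1 y.2) x - u x.1 x.2)
      ≤ M.drift u x.1 x.2 - M.penalty x.1 x.2 := by
  have hrate := P.rate_mem x.1 x.2 hx
  have hgain := Model.le_pricingGain hrate (u x.1 (x.2 + 1) - u x.1 x.2)
  have harr := mul_le_mul_of_nonneg_left
    (P.apply_settle_le (f := fun y => u y.1 y.2) (m := x.2 + 1) hu hx) hrate.1
  have hserv := mul_le_mul_of_nonneg_left
    (P.apply_settle_le (f := fun y => u y.1 y.2) (m := x.2) hu ((Nat.sub_le x.1 1).trans hx))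
    (Model.totalRate_nonneg hx x.2)
  rw [clock_mul_step_sub, reward_eq, Model.drift]
  linarith

theorem reward_add_clock_mul_step_sub_eq {u : ℕ → ℕ → ℝ}
    (hu : ∀ l m, l < M.L → P.dispatch l (m + 1) = 1 → u (l + 1) m = u l (m + 1)) {x : ℕ × ℕ}
    (hx : x.1 ≤ M.L) (hrate : P.rate x.1 x.2 = M.optRate (u x.1 (x.2 + 1) - u x.1 x.2)) :
    P.reward x + M.clock * (P.step (fun y => u y.1 y.2) x - u x.1 x.2)
      = M.drift u x.1 x.2 - M.penalty x.1 x.2 := by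
  have harr := P.apply_settle_eq (f := fun y => u y.1 y.2) (m := x.2 + 1) hu hx
  have hserv := P.apply_settle_eq (f := fun y => u y.1 y.2) (m := x.2) hu
    ((Nat.sub_le x.1 1).trans hx)
  rw [clock_mul_step_sub, reward_eq, Model.drift, Model.pricingGain, harr, hserv, hrate]
  ring

variable (P) in
theorem limsup_avgReward_le_mul_value {β K : ℝ} (hβ : 0 < β) (hcd : 0 ≤ M.cd)
    (hK : M.maxRevenue ≤ K) {l : ℕ} (hl : l ≤ M.L) (m : ℕ) :
    limsup (fun T => ((P.avgReward T l m : ℝ) : EReal)) atTop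
      ≤ ((β * (M.value β K 0 0 + M.riseBound M.longQueue) : ℝ) : EReal) := by
  have hK₀ : 0 ≤ K := M.maxRevenue_nonneg.trans hK
  refine limsup_avgReward_le P.isInvariant_settledStates (u := fun x => M.value β K x.1 x.2)
    (fun x hx => ?_) (fun x hx => Model.le_value hβ hcd hK₀ hx.1 x.2)
    (P.settle_mem_settledStates hl)
  have hstep := reward_add_clock_mul_step_sub_le (P := P)
    (fun l m hl _ => Model.value_dispatch_le hβ hcd hK₀ hl m) hx.1
  have hdrift := Model.drift_value_le hβ hcd hK₀ hx.1 x.2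
  have hvalue := mul_le_mul_of_nonneg_left
    (Model.value_le_add_riseBound_longQueue hβ hcd hK hx.1 x.2) hβ.le
  linarith [Model.cost_le_penalty (M := M) K x.1 x.2]

end Drift

end Policy

namespace Model

variable {M : Model}

/-! ### The vanishing discount limit -/

section VanishingDiscount

variable (M) in
/-- The values of discounted problems with discount rates tending to `0` and truncations tending
to infinity. -/
def vanishingValue (i : ℕ) : ℕ → ℕ → ℝ := M.value (1 / ((i : ℝ) + 1)) (M.maxRevenue + i)

variable (M) in
/-- The optimal long-run average net reward. An ultrafilter is used in place of the diagonal
extraction of a convergent subsequence. -/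
def gain : ℝ :=
  limUnder (hyperfilter ℕ : Filter ℕ) fun i => 1 / ((i : ℝ) + 1) * M.vanishingValue i 0 0

variable (M) in
/-- The value of the states relative to `(0, 0)` in the average reward problem. -/
def bias (l m : ℕ) : ℝ :=
  limUnder (hyperfilter ℕ : Filter ℕ) fun i => M.vanishingValue i l m - M.vanishingValue i 0 0

theorem tendsto_limUnder_of_mem_Icc {ι : Type*} {U : Ultrafilter ι} {f : ι → ℝ} {a b : ℝ}
    (h : ∀ i, f i ∈ Icc a b) : Tendsto f U (𝓝 (limUnder U f)) := by
  have hU : ((U.map f : Ultrafilter ℝ) : Filter ℝ) ≤ 𝓟 (Icc a b) :=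
    le_principal_iff.2 (Ultrafilter.mem_map.2 (Eventually.of_forall h))
  obtain ⟨x, -, hx⟩ := isCompact_Icc.ultrafilter_le_nhds (U.map f) hU
  exact tendsto_nhds_limUnder ⟨x, hx⟩

theorem tendsto_discount :
    Tendsto (fun i : ℕ => 1 / ((i : ℝ) + 1)) (hyperfilter ℕ : Filter ℕ) (𝓝 0) :=
  tendsto_one_div_add_atTop_nhds_zero_nat.mono_left Nat.hyperfilter_le_atTop

theorem discount_pos (i : ℕ) : (0 : ℝ) < 1 / ((i : ℝ) + 1) := Nat.one_div_pos_of_nat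

theorem maxRevenue_le_maxRevenue_add (i : ℕ) : M.maxRevenue ≤ M.maxRevenue + i :=
  le_add_of_nonneg_right i.cast_nonneg

variable (M) in
theorem maxRevenue_add_nonneg (i : ℕ) : 0 ≤ M.maxRevenue + i :=
  add_nonneg M.maxRevenue_nonneg i.cast_nonneg

theorem tendsto_gain (hcd : 0 ≤ M.cd) :
    Tendsto (fun i : ℕ => 1 / ((i : ℝ) + 1) * M.vanishingValue i 0 0)
      (hyperfilter ℕ : Filter ℕ) (𝓝 M.gain) :=
  tendsto_limUnder_of_mem_Icc fun i =>
    ⟨mul_nonneg (discount_pos i).le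
      (value_zero_zero_nonneg (discount_pos i) hcd (M.maxRevenue_add_nonneg i)),
    mul_value_le (discount_pos i) hcd (M.maxRevenue_add_nonneg i) M.L.zero_le 0⟩

theorem limsup_avgReward_le_gain (P : Policy M) (hcd : 0 ≤ M.cd) {l : ℕ} (hl : l ≤ M.L) (m : ℕ) :
    limsup (fun T => ((P.avgReward T l m : ℝ) : EReal)) atTop ≤ (M.gain : EReal) := by
  have hlim := (tendsto_gain hcd).add (tendsto_discount.mul_const (M.riseBound M.longQueue))
  rw [zero_mul, add_zero] at hlim
  refine ge_of_tendsto' (EReal.tendsto_coe.2 hlim) fun i => ?_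
  rw [← mul_add]
  exact P.limsup_avgReward_le_mul_value (discount_pos i) hcd (maxRevenue_le_maxRevenue_add i) hl m

variable (hcd : 0 ≤ M.cd) (hL : 0 < M.L) {l : ℕ}

include hcd hL

theorem tendsto_bias : ∀ l ≤ M.L, ∀ m,
    Tendsto (fun i => M.vanishingValue i l m - M.vanishingValue i 0 0)
      (hyperfilter ℕ : Filter ℕ) (𝓝 (M.bias l m)) := fun l hl m =>
  tendsto_limUnder_of_mem_Icc (a := -M.fallBound l m) (b := M.riseBound m) fun i =>
    ⟨neg_le_sub_iff_le_add.2
        (value_zero_zero_le_add_fallBound (discount_pos i) hcd (M.maxRevenue_add_nonneg i) hL hl m),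
      sub_le_iff_le_add'.2
        (value_le_add_riseBound (discount_pos i) hcd (M.maxRevenue_add_nonneg i) hl m)⟩

theorem bias_le (hl : l ≤ M.L) (m : ℕ) : M.bias l m ≤ M.riseBound M.longQueue :=
  le_of_tendsto' (tendsto_bias hcd hL l hl m) fun i => sub_le_iff_le_add'.2
    (value_le_add_riseBound_longQueue (discount_pos i) hcd (maxRevenue_le_maxRevenue_add i) hl m)

theorem tendsto_drift_vanishingValue (hl : l ≤ M.L) (m : ℕ) :
    Tendsto (fun i => M.drift (M.vanishingValue i) l m) (hyperfilter ℕ : Filter ℕ)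
      (𝓝 (M.drift M.bias l m)) := by
  simpa only [drift, sub_sub_sub_cancel_right] using tendsto_drift (tendsto_bias hcd hL) hl m

theorem tendsto_cost_add_discount_mul (hl : l ≤ M.L) (m : ℕ) :
    Tendsto (fun i : ℕ => M.cost (M.maxRevenue + i) l m
        + 1 / ((i : ℝ) + 1) * M.vanishingValue i l m)
      (hyperfilter ℕ : Filter ℕ) (𝓝 (M.gain + M.penalty l m)) := by
  have hcost : Tendsto (fun i : ℕ => M.cost (M.maxRevenue + i) l m) (hyperfilter ℕ : Filter ℕ)
      (𝓝 (M.penalty l m)) := by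
    refine (tendsto_const_nhds.congr' ?_).mono_left Nat.hyperfilter_le_atTop
    filter_upwards [eventually_ge_atTop ⌈M.penalty l m⌉₊] with i hi
    exact (min_eq_left ((Nat.ceil_le.1 hi).trans (le_add_of_nonneg_left M.maxRevenue_nonneg))).symm
  have hvalue := (tendsto_discount.mul (tendsto_bias hcd hL l hl m)).add (tendsto_gain hcd)
  rw [zero_mul, zero_add] at hvalue
  rw [add_comm]
  exact (hcost.add hvalue).congr fun i => by ring

theorem drift_bias_eq_or (hl : l ≤ M.L) (m : ℕ) :
    M.drift M.bias l m = M.gain + M.penalty l m ∨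
      (l < M.L ∧ 0 < m) ∧ M.bias (l + 1) (m - 1) = M.bias l m := by
  have hor := Eventually.of_forall (f := (hyperfilter ℕ : Filter ℕ)) fun i =>
    drift_value_eq_or (discount_pos i) hcd (M.maxRevenue_add_nonneg i) hl m
  refine (Ultrafilter.eventually_or.1 hor).imp (fun h => ?_) fun h => ?_
  · exact tendsto_nhds_unique_of_eventuallyEq (tendsto_drift_vanishingValue hcd hL hl m)
      (tendsto_cost_add_discount_mul hcd hL hl m) h
  · have hlm : l < M.L ∧ 0 < m := h.exists.choose_spec.1
    refine ⟨hlm, tendsto_nhds_unique_of_eventuallyEq (tendsto_bias hcd hL _ hlm.1 _)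
      (tendsto_bias hcd hL l hl m) ?_⟩
    exact h.mono fun i hi => congrArg (· - _) hi.2

theorem drift_bias_eq_of_isType1 (hM : M.ZigzagType2) (hcr : M.cr ≤ M.cd) {m : ℕ}
    (h : M.IsType1 l m) : M.drift M.bias l m = M.gain + M.penalty l m :=
  tendsto_nhds_unique_of_eventuallyEq (tendsto_drift_vanishingValue hcd hL h.1 m)
    (tendsto_cost_add_discount_mul hcd hL h.1 m) <| Eventually.of_forall fun i =>
      drift_value_eq_of_isType1 (discount_pos i) hcd (M.maxRevenue_add_nonneg i) hM hcr h

theorem bias_dispatch_eq_of_isType2 (hM : M.ZigzagType2) (hcr : M.cd ≤ M.cr) {m : ℕ}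
    (h : M.IsType2 l (m + 1)) : M.bias (l + 1) m = M.bias l (m + 1) :=
  tendsto_nhds_unique_of_eventuallyEq (tendsto_bias hcd hL _ h.lt m)
    (tendsto_bias hcd hL l h.lt.le _) <| Eventually.of_forall fun i => congrArg (· - _)
      (value_dispatch_eq_of_isType2 (discount_pos i) hcd (M.maxRevenue_add_nonneg i) hM hcr h)

end VanishingDiscount

end Model

namespace Policy

variable {M : Model}

/-! ### Greedy policies -/

section Greedy

open Classical in
/-- The policy that prices optimally for the relative values `h`, and dispatches in the region `φ`
wherever that is possible. -/
def greedy (h : ℕ → ℕ → ℝ) (φ : ℕ → ℕ → Prop) : Policy M where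
  rate l m := M.optRate (h l (m + 1) - h l m)
  rate_mem _ _ _ := M.optRate_mem _
  dispatch l m := if (l < M.L ∧ 0 < m) ∧ φ l m then 1 else 0
  dispatch_no_rider l := by simp
  dispatch_no_driver m := by simp

variable {h : ℕ → ℕ → ℝ} {φ : ℕ → ℕ → Prop} {l m : ℕ}

theorem greedy_dispatch_eq_one_iff :
    (greedy (M := M) h φ).dispatch l m = 1 ↔ (l < M.L ∧ 0 < m) ∧ φ l m := by
  simp [greedy, and_assoc]

theorem greedy_dispatch_eq_zero_iff :
    (greedy (M := M) h φ).dispatch l m = 0 ↔ ¬ ((l < M.L ∧ 0 < m) ∧ φ l m) := by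
  simp [greedy]

theorem isZigzag_greedy_isType2 (hM : M.ZigzagType2) (h : ℕ → ℕ → ℝ) :
    (greedy (M := M) h M.IsType2).IsZigzag := by
  have hle {a b : Fin 2} (hab : a = 1 → b = 1) : a ≤ b := by revert a b; decide
  have hone {l m} : (greedy (M := M) h M.IsType2).dispatch l m = 1 ↔ M.IsType2 l m :=
    greedy_dispatch_eq_one_iff.trans ⟨And.right, fun h₂ => ⟨⟨h₂.lt, h₂.pos⟩, h₂⟩⟩
  refine ⟨fun l _ => monotone_nat_of_le_succ fun m => hle fun h₁ => ?_,
    fun m l _ l' _ hll' => hle ?_⟩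
  · exact hone.2 (hM.succ_right (hone.1 h₁))
  · simp only [hone]
    clear * - hll' hM
    induction hll' with
    | refl => exact id
    | step _ ih => exact fun h₂ => ih (hM.of_succ_left h₂)

theorem isOptimal_greedy_bias (hcd : 0 ≤ M.cd) (hL : 0 < M.L)
    (hdispatch : ∀ l m, l < M.L → φ l (m + 1) → M.bias (l + 1) m = M.bias l (m + 1))
    (hhold : ∀ l m, l ≤ M.L → ¬ ((l < M.L ∧ 0 < m) ∧ φ l m) →
      M.drift M.bias l m = M.gain + M.penalty l m) :
    (greedy (M := M) M.bias φ).IsOptimal := by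
  refine isOptimal_of_le_avgReward (g := fun _ _ => M.gain)
    (fun Q l m hl => Model.limsup_avgReward_le_gain Q hcd hl m) fun l m hl => ⟨_, fun T hT =>
      le_avgReward (isInvariant_settledStates _) (u := fun x => M.bias x.1 x.2)
        (fun x hx => ?_) (fun x hx => Model.bias_le hcd hL hx.1 x.2)
        (settle_mem_settledStates _ hl) hT⟩
  have hdrift := hhold x.1 x.2 hx.1 (greedy_dispatch_eq_zero_iff.1 hx.2)
  have hstep := reward_add_clock_mul_step_sub_eq (P := greedy M.bias φ)
    (fun l m hl h₁ => hdispatch l m hl (greedy_dispatch_eq_one_iff.1 h₁).2) hx.1 rfl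
  exact (eq_sub_of_add_eq hdrift.symm).trans hstep.symm |>.le

end Greedy

end Policy

namespace Model

variable {M : Model}

section Optimal

theorem exists_isOptimal_hold_of_isType1 (hM : M.ZigzagType2) (hcr : M.cr ≤ M.cd) :
    ∃ P : Policy M, P.IsOptimal ∧ ∀ l m, M.IsType1 l m → P.dispatch l m = 0 := by
  rcases M.L.eq_zero_or_pos with hL | hL
  · exact ⟨_, Policy.isOptimal_idle hL, fun _ _ _ => rfl⟩
  have hcd : 0 ≤ M.cd := M.wqr_pos.le.trans hcr
  refine ⟨_, Policy.isOptimal_greedy_bias hcd hL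
    (φ := fun l m => M.drift M.bias l m ≠ M.gain + M.penalty l m) (fun l m hl h => ?_)
    (fun l m hl h => ?_), fun l m h => Policy.greedy_dispatch_eq_zero_iff.2 fun h' => ?_⟩
  · exact ((drift_bias_eq_or hcd hL hl.le (m + 1)).resolve_left h).2
  · exact (drift_bias_eq_or hcd hL hl m).elim id fun h' => of_not_not fun hne => h ⟨h'.1, hne⟩
  · exact h'.2 (drift_bias_eq_of_isType1 hcd hL hM hcr h)

theorem exists_isOptimal_dispatch_of_isType2 (hM : M.ZigzagType2) (hcd : 0 ≤ M.cd)
    (hcr : M.cd ≤ M.cr) :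
    ∃ P : Policy M, P.IsOptimal ∧ ∀ l m, M.IsType2 l m → P.dispatch l m = 1 := by
  rcases M.L.eq_zero_or_pos with hL | hL
  · exact ⟨_, Policy.isOptimal_idle hL, fun l m h => absurd h.lt (hL ▸ l.not_lt_zero)⟩
  refine ⟨_, Policy.isOptimal_greedy_bias hcd hL
    (φ := fun l m => M.bias (l + 1) (m - 1) = M.bias l m) (fun l m _ h => h)
    (fun l m hl h => ?_), fun l m h => Policy.greedy_dispatch_eq_one_iff.2 ⟨⟨h.lt, h.pos⟩, ?_⟩⟩
  · exact (drift_bias_eq_or hcd hL hl m).resolve_right h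
  · obtain ⟨m, rfl⟩ := Nat.exists_eq_add_one.2 h.pos
    exact bias_dispatch_eq_of_isType2 hcd hL hM hcr h

theorem exists_isOptimal_isZigzag (hM : M.ZigzagType2) (h : M.cd = M.cr) :
    ∃ P : Policy M, P.IsOptimal ∧ P.IsZigzag ∧ (∀ l m, M.IsType1 l m → P.dispatch l m = 0) ∧
      ∀ l m, M.IsType2 l m → P.dispatch l m = 1 := by
  rcases M.L.eq_zero_or_pos with hL | hL
  · exact ⟨_, Policy.isOptimal_idle hL, ⟨fun _ _ => monotone_const, fun _ => antitoneOn_const⟩,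
      fun _ _ _ => rfl, fun l m h => absurd h.lt (hL ▸ l.not_lt_zero)⟩
  have hcd : 0 ≤ M.cd := M.wqr_pos.le.trans_eq h.symm
  refine ⟨_, Policy.isOptimal_greedy_bias hcd hL (φ := M.IsType2)
    (fun l m _ h₂ => bias_dispatch_eq_of_isType2 hcd hL hM h.le h₂) (fun l m hl h₂ => ?_),
    Policy.isZigzag_greedy_isType2 hM _,
    fun l m h₁ => Policy.greedy_dispatch_eq_zero_iff.2 fun h₂ => h₂.2.2 h₁,
    fun l m h₂ => Policy.greedy_dispatch_eq_one_iff.2 ⟨⟨h₂.lt, h₂.pos⟩, h₂⟩⟩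
  have h₁ : M.IsType1 l m := of_not_not fun h₁ =>
    have h' : M.IsType2 l m := ⟨hl, h₁⟩
    h₂ ⟨⟨h'.lt, h'.pos⟩, h'⟩
  exact drift_bias_eq_of_isType1 hcd hL hM h.ge h₁

end Optimal

end Model

end SpatialQueue

end

theorem theorem1_general (M : SpatialQueue.Model) (hM : M.ZigzagType2) :
    (M.cd = M.cr → ∃ P : SpatialQueue.Policy M, P.IsOptimal ∧ P.IsZigzag ∧
      (∀ l m, M.IsType1 l m → P.dispatch l m = 0) ∧
      (∀ l m, M.IsType2 l m → P.dispatch l m = 1)) ∧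
    (M.cr < M.cd → ∃ P : SpatialQueue.Policy M, P.IsOptimal ∧
      (∀ l m, M.IsType1 l m → P.dispatch l m = 0)) ∧
    (0 ≤ M.cd → M.cd < M.cr → ∃ P : SpatialQueue.Policy M, P.IsOptimal ∧
      (∀ l m, M.IsType2 l m → P.dispatch l m = 1)) :=
  ⟨SpatialQueue.Model.exists_isOptimal_isZigzag hM,
    fun hcr => SpatialQueue.Model.exists_isOptimal_hold_of_isType1 hM hcr.le,
    fun hcd hcr => SpatialQueue.Model.exists_isOptimal_dispatch_of_isType2 hM hcd hcr.le⟩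

theorem theorem1 (M : SpatialQueue.Model) (hμ : M.DiminishingReturns) :
    (M.cd = M.cr → ∃ P : SpatialQueue.Policy M, P.IsOptimal ∧ P.IsZigzag ∧
      (∀ l m, M.IsType1 l m → P.dispatch l m = 0) ∧
      (∀ l m, M.IsType2 l m → P.dispatch l m = 1)) ∧
    (M.cr < M.cd → ∃ P : SpatialQueue.Policy M, P.IsOptimal ∧
      (∀ l m, M.IsType1 l m → P.dispatch l m = 0)) ∧
    (0 ≤ M.cd → M.cd < M.cr → ∃ P : SpatialQueue.Policy M, P.IsOptimal ∧
      (∀ l m, M.IsType2 l m → P.dispatch l m = 1)) :=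
  theorem1_general M hμ.zigzagType2
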